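/- Let $L$ be a CM field with maximal totally real subfield $k$, so that $[L:k]=2$, and let $\mathcal O_L,\mathcal O_k$ be the rings of integers. Let $\mathrm N=\mathrm N^L_k$ be the norm, extended to $\mathcal O_L\otimes_{\mathcal O_k}R$ for every commutative $\mathcal O_k$-algebra $R$ by $\mathrm N(g)=g\,\sigma(g)$, where $\sigma$ is induced by the non-trivial element of $\mathrm{Gal}(L/k)$. Then the group functor $$R\longmapsto \mathrm T(R)=\{g\in(\mathcal O_L\otimes_{\mathcal O_k}R)^*\mid \mathrm N(g)=1\}$$ on commutative $\mathcal O_k$-algebras is represented by an affine flat group scheme $\mathrm T/\mathrm{Spec}(\mathcal O_k)$, which has the following properties. 1. The generic fibre is $\mathrm T_k\simeq \mathrm{Res}^L_k(\mathbb G_{m,L})^{(1)}$, where for a finite field extension $F'/F$ we write $\mathrm{Res}^{F'}_F(\mathbb G_{m,F'})^{(1)}$ for the kernel of the norm $\mathrm{Res}^{F'}_F(\mathbb G_{m,F'})\to\mathbb G_{m,F}$, that is, for the group scheme over $F$ with functor of points $A\mapsto\{g\in(F'\otimes_F A)^*\mid \mathrm N_{F'\otimes_F A/A}(g)=1\}$.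 2. For every prime $0\neq\mathfrak p\subseteq\mathcal O_k$, with $\kappa(\mathfrak p)=\mathcal O_k/\mathfrak p$ and $\kappa(\mathfrak p)^{(2)}$ the (up to isomorphism unique) quadratic extension field of $\kappa(\mathfrak p)$, there is an isomorphism of group schemes over $\kappa(\mathfrak p)$ $$\mathrm T_{\kappa(\mathfrak p)}\simeq\begin{cases}\mathbb G_{m,\kappa(\mathfrak p)} & \text{if } \mathfrak p \text{ splits in } L/k,\\ \mathrm{Res}^{\kappa(\mathfrak p)^{(2)}}_{\kappa(\mathfrak p)}(\mathbb G_{m,\kappa(\mathfrak p)^{(2)}})^{(1)} & \text{if } \mathfrak p \text{ is inert in } L/k,\\ \mathbb G_{a,\kappa(\mathfrak p)}\times\mu_{2,\kappa(\mathfrak p)} & \text{if } \mathfrak p \text{ is ramified in } L/k.\end{cases}$$ 3. The largest open subscheme of $\mathrm{Spec}(\mathcal O_k)$ over which $\mathrm T$ is smooth is $$\mathcal U=\mathrm{Spec}(\mathcal O_k)-\{0\neq\mathfrak p\mid \mathfrak p \text{ has residue characteristic } 2 \text{ and is ramified in } L/k\}.$$ -/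

import Mathlib

open CategoryTheory AlgebraicGeometry NumberField Opposite
open scoped TensorProduct

universe u

noncomputable section

/-! ### Group schemes over an affine base -/

/-- Group schemes over `Spec R`. -/
abbrev GroupSchemeOver (R : Type u) [CommRing R] : Type (u + 1) :=
  Grp (Over (Spec (CommRingCat.of R)))

namespace GroupSchemeOver

/-- The functor of points `A ↦ G(A) = Hom_{Spec R}(Spec A, G)` of a group scheme `G` over `Spec R`,
as a group-valued functor on commutative `R`-algebras. -/
def points {R : Type u} [CommRing R] (G : GroupSchemeOver R) : CommAlgCat.{u} R ⥤ GrpCat.{u} :=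
  (algSpec (CommRingCat.of R)).rightOp ⋙ yonedaGrp.obj G

/-- `G` represents the group-valued functor `F` on `R`-algebras: there are group isomorphisms
`G(A) ≅ F(A)`, natural in the `R`-algebra `A`. A group scheme over `Spec R` is determined by `F`
up to isomorphism of group schemes. -/
def Represents {R : Type u} [CommRing R] (G : GroupSchemeOver R)
    (F : CommAlgCat.{u} R ⥤ GrpCat.{u}) : Prop :=
  Nonempty (G.points ≅ F)

/-- The base change `G ×_{Spec R} Spec S`, with its induced structure of a group scheme. -/
def baseChange {R : Type u} [CommRing R] (G : GroupSchemeOver R)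
    (S : Type u) [CommRing S] [Algebra R S] : GroupSchemeOver S :=
  (Over.pullback (Spec.map (CommRingCat.ofHom (algebraMap R S)))).mapGrp.obj G

end GroupSchemeOver

/-! ### The group functors `𝔾ₘ` and `𝔾ₐ × μ₂` -/

/-- The multiplicative group `A ↦ Aˣ` over `R`. -/
def multiplicativeGroup (R : Type u) [CommRing R] : CommAlgCat.{u} R ⥤ GrpCat.{u} where
  obj A := GrpCat.of Aˣ
  map f := GrpCat.ofHom (Units.map (f.hom : _ →* _))
  map_id A := by ext; rfl
  map_comp f g := by ext; rfl

/-- The group `A ↦ 𝔾ₐ(A) × μ₂(A) = (A, +) × {x ∈ Aˣ | x² = 1}` over `R`. -/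
def additiveTimesMuTwo (R : Type u) [CommRing R] : CommAlgCat.{u} R ⥤ GrpCat.{u} where
  obj A := GrpCat.of (Multiplicative A × rootsOfUnity 2 A)
  map f := GrpCat.ofHom
    (MonoidHom.prodMap (AddMonoidHom.toMultiplicative (f.hom : _ →+ _))
      (restrictRootsOfUnity f.hom 2))
  map_id A := by ext x <;> rfl
  map_comp f g := by ext x <;> rfl

/-! ### Norm-one groups -/

/-- For an `R`-algebra `S`, the group homomorphism `(A ⊗ S)ˣ → (B ⊗ S)ˣ` induced by a homomorphism
`A → B` of `R`-algebras: the functoriality of the Weil restriction of `𝔾ₘ` from `S` to `R`. -/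
def weilUnitsMap {R : Type u} [CommRing R] (S : Type u) [CommRing S] [Algebra R S]
    {A B : CommAlgCat.{u} R} (f : A ⟶ B) : (A ⊗[R] S)ˣ →* (B ⊗[R] S)ˣ :=
  Units.map (Algebra.TensorProduct.map f.hom (AlgHom.id R S) : A ⊗[R] S →* B ⊗[R] S)

lemma weilUnitsMap_id {R : Type u} [CommRing R] (S : Type u) [CommRing S] [Algebra R S]
    (A : CommAlgCat.{u} R) : weilUnitsMap S (𝟙 A) = MonoidHom.id _ := by
  ext g
  simp [weilUnitsMap]

lemma weilUnitsMap_comp {R : Type u} [CommRing R] (S : Type u) [CommRing S] [Algebra R S]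
    {A B C : CommAlgCat.{u} R} (f : A ⟶ B) (g : B ⟶ C) :
    weilUnitsMap S (f ≫ g) = (weilUnitsMap S g).comp (weilUnitsMap S f) := by
  ext x
  simp only [weilUnitsMap, Units.coe_map, MonoidHom.comp_apply, MonoidHom.coe_coe,
    CommAlgCat.hom_comp]
  induction (x : A ⊗[R] S) with
  | zero => simp
  | tmul a s => simp
  | add y z hy hz => simp only [map_add, hy, hz]

/-- The subfunctor of `A ↦ (A ⊗_R S)ˣ` given by a family of subgroups stable under functoriality. -/
def weilUnitsSubfunctor {R : Type u} [CommRing R] (S : Type u) [CommRing S] [Algebra R S]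
    (H : ∀ A : CommAlgCat.{u} R, Subgroup (A ⊗[R] S)ˣ)
    (hH : ∀ {A B : CommAlgCat.{u} R} (f : A ⟶ B), ∀ g ∈ H A, weilUnitsMap S f g ∈ H B) :
    CommAlgCat.{u} R ⥤ GrpCat.{u} where
  obj A := GrpCat.of (H A)
  map {A B} f := GrpCat.ofHom
    (((weilUnitsMap S f).comp (H A).subtype).codRestrict (H B) (fun g => hH f g.1 g.2))
  map_id A := by
    ext g
    exact congrArg Units.val (DFunLike.congr_fun (weilUnitsMap_id S A) g.1)
  map_comp {A B C} f g := by
    ext x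
    exact congrArg Units.val (DFunLike.congr_fun (weilUnitsMap_comp S f g) x.1)

section FreeCase

variable (R S : Type u) [CommRing R] [CommRing S] [Algebra R S]
  [Module.Free R S] [Module.Finite R S]

lemma norm_tensorProduct_map {A B : CommAlgCat.{u} R} (f : A ⟶ B) (x : A ⊗[R] S) :
    Algebra.norm B (Algebra.TensorProduct.map f.hom (AlgHom.id R S) x) =
      f.hom (Algebra.norm A x) := by
  let b := Module.Free.chooseBasis R S
  rw [Algebra.norm_eq_matrix_det (Algebra.TensorProduct.basis A b),
    Algebra.norm_eq_matrix_det (Algebra.TensorProduct.basis B b), AlgHom.map_det]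
  congr 1
  ext i j
  have key : ∀ y : A ⊗[R] S, (Algebra.TensorProduct.basis B b).repr
      (Algebra.TensorProduct.map f.hom (AlgHom.id R S) y) i =
        f.hom ((Algebra.TensorProduct.basis A b).repr y i) := by
    intro y
    induction y with
    | zero => simp
    | tmul a s => simp
    | add y z hy hz => simp [hy, hz]
  have := key (x * (Algebra.TensorProduct.basis A b) j)
  simpa [Algebra.leftMulMatrix_eq_repr_mul] using this

/-- The kernel of the norm `Res_{S/R}(𝔾ₘ) → 𝔾ₘ` for an algebra `S` which is finite free over `R`
(for instance a finite field extension): the group functor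
`A ↦ {g ∈ (A ⊗_R S)ˣ | N_{A ⊗_R S / A}(g) = 1}`. -/
def normOneTorus : CommAlgCat.{u} R ⥤ GrpCat.{u} :=
  weilUnitsSubfunctor S (fun A => (Units.map (Algebra.norm A : A ⊗[R] S →* A)).ker)
    (fun {A B} f g hg => by
      have hg : Algebra.norm A (g : A ⊗[R] S) = 1 := by
        simpa using congrArg Units.val (MonoidHom.mem_ker.1 hg)
      rw [MonoidHom.mem_ker]
      ext
      simpa [weilUnitsMap, hg] using norm_tensorProduct_map R S f (g : A ⊗[R] S))

end FreeCase

section RingOfIntegers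

variable (k L : Type u) [Field k] [Field L] [NumberField k] [NumberField L] [Algebra k L]

/-- The norm of `A ⊗ 𝓞 L` over `A` for a Galois extension `L/k` of number fields and an
`𝓞 k`-algebra `A`, as a product of conjugates: `g ↦ ∏_{τ ∈ Gal(L/k)} (id ⊗ τ)(g)`.
Its values lie in the subring `A` of `A ⊗ 𝓞 L`. (As `𝓞 L` need not be free over `𝓞 k`,
`Algebra.norm A`, which is defined through a basis, cannot be used here.) -/
def integralGaloisNorm (A : Type u) [CommRing A] [Algebra (𝓞 k) A] :
    A ⊗[𝓞 k] 𝓞 L →* A ⊗[𝓞 k] 𝓞 L :=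
  ∏ τ : Gal(L/k), (Algebra.TensorProduct.map (AlgHom.id (𝓞 k) A)
    (galRestrict (𝓞 k) k L (𝓞 L) τ : 𝓞 L →ₐ[𝓞 k] 𝓞 L) : A ⊗[𝓞 k] 𝓞 L →* A ⊗[𝓞 k] 𝓞 L)

lemma integralGaloisNorm_one_tmul [IsGalois k L] (A : Type u) [CommRing A] [Algebra (𝓞 k) A]
    (x : 𝓞 L) : integralGaloisNorm k L A (1 ⊗ₜ x) =
      algebraMap (𝓞 k) (A ⊗[𝓞 k] 𝓞 L) (RingOfIntegers.norm k x) := by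
  have h : ∏ τ : Gal(L/k), galRestrict (𝓞 k) k L (𝓞 L) τ x =
      algebraMap (𝓞 k) (𝓞 L) (RingOfIntegers.norm k x) := by
    apply RingOfIntegers.coe_injective
    refine Eq.trans ?_ (RingOfIntegers.coe_algebraMap_norm k x).symm
    rw [Algebra.norm_eq_prod_automorphisms, map_prod]
    exact Finset.prod_congr rfl fun τ _ => algebraMap_galRestrict_apply (𝓞 k) τ x
  have h' := congrArg (Algebra.TensorProduct.includeRight : 𝓞 L →ₐ[𝓞 k] A ⊗[𝓞 k] 𝓞 L) h
  rw [map_prod, AlgHom.commutes] at h'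
  rw [← h']
  simp [integralGaloisNorm, MonoidHom.finsetProd_apply]

lemma integralGaloisNorm_map {A B : CommAlgCat.{u} (𝓞 k)} (f : A ⟶ B) (x : A ⊗[𝓞 k] 𝓞 L) :
    integralGaloisNorm k L B (Algebra.TensorProduct.map f.hom (AlgHom.id (𝓞 k) (𝓞 L)) x) =
      Algebra.TensorProduct.map f.hom (AlgHom.id (𝓞 k) (𝓞 L)) (integralGaloisNorm k L A x) := by
  simp only [integralGaloisNorm, MonoidHom.finsetProd_apply, map_prod, MonoidHom.coe_coe]
  refine Finset.prod_congr rfl fun τ _ => ?_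
  induction x with
  | zero => simp
  | tmul a s => simp
  | add y z hy hz => simp only [map_add, hy, hz]

/-- The norm-one group of `𝓞 L` over `𝓞 k`: the group functor
`A ↦ {g ∈ (A ⊗ 𝓞 L)ˣ | N_{L/k}(g) = 1}` on `𝓞 k`-algebras. -/
def integralNormOneGroup : CommAlgCat.{u} (𝓞 k) ⥤ GrpCat.{u} :=
  weilUnitsSubfunctor (𝓞 L) (fun A => (Units.map (integralGaloisNorm k L A)).ker)
    (fun {A B} f g hg => by
      have hg : integralGaloisNorm k L A (g : A ⊗[𝓞 k] 𝓞 L) = 1 := by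
        simpa using congrArg Units.val (MonoidHom.mem_ker.1 hg)
      rw [MonoidHom.mem_ker]
      ext
      simpa [weilUnitsMap, hg] using integralGaloisNorm_map k L f (g : A ⊗[𝓞 k] 𝓞 L))

end RingOfIntegers

/-! ### Splitting of primes in a quadratic extension, and the open subscheme `U` -/

section Primes

variable (k L : Type u) [Field k] [Field L] [NumberField k] [NumberField L] [Algebra k L]

/-- `p 𝓞_L` is a product of two distinct primes. -/
def SplitsInQuadratic (p : Ideal (𝓞 k)) : Prop :=
  ∃ q₁ q₂ : Ideal (𝓞 L), q₁.IsPrime ∧ q₂.IsPrime ∧ q₁ ≠ q₂ ∧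
    p.map (algebraMap (𝓞 k) (𝓞 L)) = q₁ * q₂

/-- `p 𝓞_L` is a prime. -/
def IsInertInQuadratic (p : Ideal (𝓞 k)) : Prop :=
  (p.map (algebraMap (𝓞 k) (𝓞 L))).IsPrime

/-- `p 𝓞_L` is the square of a prime. -/
def IsRamifiedInQuadratic (p : Ideal (𝓞 k)) : Prop :=
  ∃ q : Ideal (𝓞 L), q.IsPrime ∧ p.map (algebraMap (𝓞 k) (𝓞 L)) = q ^ 2

/-- The open subscheme of `Spec 𝓞_k` obtained by removing the nonzero primes of residue
characteristic `2` which are ramified in `L/k`. -/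
def tameLocus : (Spec (CommRingCat.of (𝓞 k))).Opens where
  carrier := {p : PrimeSpectrum (𝓞 k) |
    ¬ (p.asIdeal ≠ ⊥ ∧ CharP (𝓞 k ⧸ p.asIdeal) 2 ∧ IsRamifiedInQuadratic k L p.asIdeal)}
  is_open' := by
    let Z : Set (PrimeSpectrum (𝓞 k)) :=
      {p | p.asIdeal ≠ ⊥ ∧ CharP (𝓞 k ⧸ p.asIdeal) 2 ∧ IsRamifiedInQuadratic k L p.asIdeal}
    have hfin : Z.Finite := by
      have h2 := Ring.HasFiniteQuotients.finite_setOfPred_mem (2 : 𝓞 k) two_ne_zero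
      refine Set.Finite.subset
        (h2.preimage (f := PrimeSpectrum.asIdeal) (fun x _ y _ h => PrimeSpectrum.ext h)) ?_
      rintro p ⟨-, hp, -⟩
      have := CharP.cast_eq_zero (𝓞 k ⧸ p.asIdeal) 2
      exact Ideal.Quotient.eq_zero_iff_mem.1 (by rw [map_ofNat]; exact_mod_cast this)
    have hcl : IsClosed Z := by
      rw [← Set.biUnion_of_singleton Z]
      refine hfin.isClosed_biUnion fun p hp => ?_
      rw [PrimeSpectrum.isClosed_singleton_iff_isMaximal]
      exact p.isPrime.isMaximal hp.1
    exact hcl.isOpen_compl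

end Primes

end

/-!
Write `R = 𝓞 k`, `S = 𝓞 L`, and let `σ` be the non-trivial automorphism of `L / k`, so that the
functor sends `A` to the elements `g` of `A ⊗ S` with `g * σ g = 1`.

As `S` is finite projective over `R`, the functor is corepresented by a finitely presented
`R`-algebra `H`, generated by the coordinates of a universal element of norm one
(`exists_isUniversalNormOne`); Yoneda turns `Spec H` into the group scheme `T`
(`GroupSchemeOver.exists_represents`), and the fibres of `T` represent the restrictions of the
functor (`GroupSchemeOver.Represents.baseChange`).

Everything else is read off in quadratic coordinates. Over a local `R`-algebra `F` the algebra
`F ⊗ S` is free of rank two with `1` in a basis, hence isomorphic to a quadratic algebra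
`F[ω] / (ω² - b ω - a)` with `σ` as its canonical involution (`hasQuadraticCoordinates`), and over
`F` the group becomes the group of elements of norm one of this quadratic algebra
(`restrictScalarsIsoNormOneTorus`).

* Flatness: over a localization `F` of `R`, the algebra `F ⊗ H` is a retract of
  `F[v][y] / (y² + b v y - a v² - 1)`, which is free over `F[v]`.
* Generic fibre: `k ⊗ S = L`.
* Closed fibres: for `F = R / p`, the algebra `S / p S` is the quadratic algebra, so `p` is split,
  inert or ramified according as `X² - b X - a` has two distinct roots, no root or a double root
  modulo `p`. For roots `r`, `s` the norm form is `(x + r y) (x + s y)`. If `r ≠ s`, then evaluation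
  at `r` is an isomorphism to `𝔾ₘ`. If `r = s`, then `x + r y` is a square root of unity `ζ`, and
  `(ζ y, ζ)` gives the isomorphism to `𝔾ₐ × μ₂`.
* Smoothness: if a trace `x + σ x = t` is invertible, then norm-one elements lift along square-zero
  extensions (`exists_lift_mul_conj_eq_one`). If instead all traces lie in `p`, then `2 ∈ p`, and
  modulo `p` the polynomial is `X² - a` with `a` a square, so `p` is ramified of residue
  characteristic two. At such a prime the fibre is `𝔾ₐ × μ₂` in characteristic two, and the
  norm-one element `1 + X` over `F[X] / (X²)` has no lift of norm one to `F[X] / (X³)`.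
-/

universe v

/-! ### Group schemes from corepresentable functors, and their base change -/

namespace CommAlgCat

/-- Restriction of scalars of commutative algebras along `R → S`. -/
noncomputable def restrictScalars (R S : Type u) [CommRing R] [CommRing S] [Algebra R S] :
    CommAlgCat.{u} S ⥤ CommAlgCat.{u} R where
  obj A := @CommAlgCat.of R _ A _ (Algebra.compHom A (algebraMap R S))
  map {A B} f := @CommAlgCat.ofHom R _ A B _ (Algebra.compHom A (algebraMap R S)) _
    (Algebra.compHom B (algebraMap R S))
    (@AlgHom.mk R A B _ _ _ (Algebra.compHom A (algebraMap R S))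
      (Algebra.compHom B (algebraMap R S)) f.hom.toRingHom
      (fun r => f.hom.commutes (algebraMap R S r)))
  map_id _ := rfl
  map_comp _ _ := rfl

end CommAlgCat

section
open MonObj
open scoped CategoryTheory.Obj

/-- For a right adjoint `U` between cartesian monoidal categories and a monoid object `M`, the
bijection `Hom(F X, M) ≃ Hom(X, U M)` is multiplicative. -/
def CategoryTheory.Adjunction.homMulEquiv {C D : Type*} [Category C] [Category D]
    [CartesianMonoidalCategory C] [CartesianMonoidalCategory D] {F : C ⥤ D} {U : D ⥤ C}
    [U.Monoidal] (adj : F ⊣ U) (X : C) (M : D) [MonObj M] : (F.obj X ⟶ M) ≃* (X ⟶ U.obj M) where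
  toEquiv := adj.homEquiv X M
  map_mul' x y := by
    simp [Adjunction.homEquiv_unit, Functor.map_mul, comp_mul]

/-- If `F ⊣ U` and `U` is monoidal, then `U G` represents `X ↦ Hom(F X, G)` for every group
object `G`. -/
def CategoryTheory.Adjunction.yonedaGrpIso {C : Type*} {D : Type*} [Category.{v} C]
    [Category.{v} D] [CartesianMonoidalCategory C] [CartesianMonoidalCategory D] {F : C ⥤ D}
    {U : D ⥤ C} [U.Monoidal] (adj : F ⊣ U) (G : Grp D) :
    F.op ⋙ yonedaGrp.obj G ≅ yonedaGrp.obj (U.mapGrp.obj G) :=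
  NatIso.ofComponents (fun X => MulEquiv.toGrpIso (adj.homMulEquiv X.unop G.X))
    (fun f => by
      ext x
      exact adj.homEquiv_naturality_left f.unop x)

end

/-- A group functor on `R`-algebras which is corepresentable by `H` as a set-valued functor is
represented by a group scheme with underlying scheme `Spec H`. -/
theorem GroupSchemeOver.exists_iso_of_corepresentableBy {R : CommRingCat.{u}}
    (F : CommAlgCat.{u} R ⥤ GrpCat.{u}) (H : CommAlgCat.{u} R)
    (α : (F ⋙ forget _).CorepresentableBy H) :
    ∃ T : Grp (Over (Spec R)), Nonempty ((algSpec R).rightOp ⋙ yonedaGrp.obj T ≅ F) ∧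
      T.X = (algSpec R).obj (op H) := by
  let α' : ((unopUnop _ ⋙ F) ⋙ forget _).RepresentableBy (op H) :=
    { homEquiv := fun {X} => (opEquiv _ _).trans α.homEquiv
      homEquiv_comp := fun {X Y} f g => α.homEquiv_comp f.unop g.unop }
  let := GrpObj.ofRepresentableBy (op H) (unopUnop _ ⋙ F) α'
  let T := (algSpec R).mapGrp.obj ⟨op H⟩
  let e : opOp _ ⋙ yonedaGrpObj (op H) ≅ (algSpec R).rightOp ⋙ yonedaGrp.obj T :=
    NatIso.ofComponents
      (fun A => MulEquiv.toGrpIso (Functor.FullyFaithful.homMulEquiv _ algSpec.fullyFaithful))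
      (fun {A B} f => by
        ext x
        exact (algSpec R).map_comp f.op x)
  exact ⟨T, ⟨e.symm ≪≫ Functor.isoWhiskerLeft (opOp _) (yonedaGrpObjIsoOfRepresentableBy _ _ α')⟩,
    rfl⟩

/-- The result of `GroupSchemeOver.exists_iso_of_corepresentableBy` over `Spec R`, for a ring `R` in
place of an object of `CommRingCat`. -/
theorem GroupSchemeOver.exists_represents {R : Type u} [CommRing R]
    (F : CommAlgCat.{u} R ⥤ GrpCat.{u}) (H : CommAlgCat.{u} R)
    (α : (F ⋙ forget _).CorepresentableBy H) :
    ∃ T : GroupSchemeOver R, T.Represents F ∧ T.X = (algSpec (.of R)).obj (op H) :=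
  exists_iso_of_corepresentableBy (R := .of R) F H α

section BaseChange

variable {R : Type u} [CommRing R] (S : Type u) [CommRing S] [Algebra R S]

lemma specMap_algebraMap_tower (A : Type u) [CommRing A] [Algebra R A] [Algebra S A]
    [IsScalarTower R S A] :
    Spec.map (CommRingCat.ofHom (algebraMap R A)) =
      Spec.map (CommRingCat.ofHom (algebraMap S A)) ≫
        Spec.map (CommRingCat.ofHom (algebraMap R S)) := by
  rw [IsScalarTower.algebraMap_eq R S A, CommRingCat.ofHom_comp, Spec.map_comp]

/-- For an `S`-algebra `A`, the `R`-scheme `Spec A` is the `S`-scheme `Spec A` regarded as an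
`R`-scheme. -/
noncomputable def overMkSpecTowerIso (A : Type u) [CommRing A] [Algebra R A] [Algebra S A]
    [IsScalarTower R S A] :
    Over.mk (Spec.map (CommRingCat.ofHom (algebraMap R A))) ≅
      (Over.map (Spec.map (CommRingCat.ofHom (algebraMap R S)))).obj
        (Over.mk (Spec.map (CommRingCat.ofHom (algebraMap S A)))) :=
  Over.isoMk (Iso.refl (Spec (.of A)))
    ((Category.id_comp _).trans (specMap_algebraMap_tower (R := R) S A).symm)

/-- The isomorphism `overMkSpecTowerIso`, in terms of the functors `algSpec`. -/
noncomputable def algSpecTowerIso (A : Type u) [CommRing A] [Algebra R A] [Algebra S A]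
    [IsScalarTower R S A] :
    (algSpec (.of R)).obj (op (CommAlgCat.of R A)) ≅
      (Over.map (Spec.map (CommRingCat.ofHom (algebraMap R S)))).obj
        ((algSpec (.of S)).obj (op (.of S A))) :=
  overMkSpecTowerIso S A

lemma algSpecTowerIso_hom_naturality {A B : Type u} [CommRing A] [Algebra R A] [Algebra S A]
    [IsScalarTower R S A] [CommRing B] [Algebra R B] [Algebra S B] [IsScalarTower R S B]
    (f : A →ₐ[S] B) :
    (algSpec (.of R)).map (CommAlgCat.ofHom (f.restrictScalars R)).op ≫ (algSpecTowerIso S A).hom =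
      (algSpecTowerIso S B).hom ≫ (Over.map (Spec.map (CommRingCat.ofHom (algebraMap R S)))).map
        ((algSpec (.of S)).map (CommAlgCat.ofHom f).op) := by
  apply Over.OverMorphism.ext
  exact (Category.comp_id (Spec.map (CommRingCat.ofHom f.toRingHom))).trans
    (Category.id_comp (Spec.map (CommRingCat.ofHom f.toRingHom))).symm

/-- `Spec` is compatible with restriction of scalars. -/
noncomputable def restrictScalarsSpecIso :
    (algSpec (.of S)).rightOp ⋙
        (Over.map (Spec.map (CommRingCat.ofHom (algebraMap R S)))).op ≅
      CommAlgCat.restrictScalars R S ⋙ (algSpec (.of R)).rightOp :=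
  NatIso.ofComponents
    (fun A =>
      letI := Algebra.compHom A (algebraMap R S)
      haveI : IsScalarTower R S A := .of_algebraMap_eq fun _ => rfl
      (algSpecTowerIso S A).op)
    (fun {A B} f => by
      let _ := Algebra.compHom A (algebraMap R S)
      let _ := Algebra.compHom B (algebraMap R S)
      have : IsScalarTower R S A := .of_algebraMap_eq fun _ => rfl
      have : IsScalarTower R S B := .of_algebraMap_eq fun _ => rfl
      exact (congrArg Quiver.Hom.op (algSpecTowerIso_hom_naturality (R := R) S f.hom)).symm)

/-- The functor of points of a base change is the restriction of the functor of points. -/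
noncomputable def GroupSchemeOver.pointsBaseChange (G : GroupSchemeOver R) :
    (G.baseChange S).points ≅ CommAlgCat.restrictScalars R S ⋙ G.points :=
  Functor.isoWhiskerLeft (algSpec (.of S)).rightOp
      ((Over.mapPullbackAdj (Spec.map (CommRingCat.ofHom (algebraMap R S)))).yonedaGrpIso G).symm ≪≫
    (Functor.associator _ _ _).symm ≪≫
      Functor.isoWhiskerRight (restrictScalarsSpecIso S) (yonedaGrp.obj G) ≪≫
        Functor.associator _ _ _

/-- The base change to `S` of a group scheme representing `F` represents every functor isomorphic to
the restriction of `F` to `S`-algebras. -/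
theorem GroupSchemeOver.Represents.baseChange {G : GroupSchemeOver R}
    {F : CommAlgCat.{u} R ⥤ GrpCat.{u}} (h : G.Represents F) {F' : CommAlgCat.{u} S ⥤ GrpCat.{u}}
    (e : CommAlgCat.restrictScalars R S ⋙ F ≅ F') : (G.baseChange S).Represents F' :=
  ⟨G.pointsBaseChange S ≪≫ Functor.isoWhiskerLeft _ h.some ≪≫ e⟩

end BaseChange

/-! ### Norm-one groups of quadratic algebras -/

/-- The restriction of an isomorphism of groups to corresponding subgroups. -/
def MulEquiv.equivOfMemIff {G H : Type*} [Group G] [Group H] (e : G ≃* H) {K : Subgroup G}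
    {K' : Subgroup H} (h : ∀ g, g ∈ K ↔ e g ∈ K') : K ≃* K' where
  toFun g := ⟨e g.1, (h _).1 g.2⟩
  invFun g := ⟨e.symm g.1, (h _).2 (by simp)⟩
  left_inv g := by simp
  right_inv g := by simp
  map_mul' g g' := by simp

namespace QuadraticAlgebra

open Algebra.TensorProduct in
/-- The base change of a quadratic algebra. -/
noncomputable def baseChangeEquiv {F : Type*} [CommRing F] (a b : F) (A : Type*) [CommRing A]
    [Algebra F A] :
    A ⊗[F] QuadraticAlgebra F a b ≃ₐ[A]
      QuadraticAlgebra A (algebraMap F A a) (algebraMap F A b) :=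
  AlgEquiv.ofAlgHom
    (Algebra.TensorProduct.lift (Algebra.ofId A _)
      (QuadraticAlgebra.lift ⟨omega, by
        rw [omega_mul_omega_eq_add, algebraMap_smul, algebraMap_smul]⟩)
      (fun _ _ => Commute.all _ _))
    (QuadraticAlgebra.lift ⟨1 ⊗ₜ omega, by
      rw [tmul_mul_tmul, one_mul, omega_mul_omega_eq_add, TensorProduct.tmul_add,
        TensorProduct.tmul_smul, TensorProduct.tmul_smul, algebraMap_smul, algebraMap_smul]
      rfl⟩)
    (by
      apply algHom_ext
      simp)
    (by
      apply Algebra.TensorProduct.ext (by ext)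
      apply algHom_ext
      simp)

variable {F : Type*} [CommRing F] {a b : F}

@[simp]
lemma baseChangeEquiv_tmul (A : Type*) [CommRing A] [Algebra F A] (x : A)
    (z : QuadraticAlgebra F a b) :
    baseChangeEquiv a b A (x ⊗ₜ z) = ⟨x * algebraMap F A z.re, x * algebraMap F A z.im⟩ := by
  have : baseChangeEquiv a b A (x ⊗ₜ z) = algebraMap A _ x *
      (z.re • 1 + z.im • omega) := by
    simp [baseChangeEquiv, Algebra.ofId_apply]
  rw [this]
  ext <;> simp [Algebra.algebraMap_eq_smul_one]

section Naturality

variable {A B : Type*} [CommRing A] [Algebra F A] [CommRing B] [Algebra F B] (f : A →ₐ[F] B)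
  (x : A ⊗[F] QuadraticAlgebra F a b)

lemma re_baseChangeEquiv_map :
    (baseChangeEquiv a b B (Algebra.TensorProduct.map f (AlgHom.id F _) x)).re =
      f (baseChangeEquiv a b A x).re := by
  induction x with
  | zero => simp
  | tmul x z => simp
  | add x y hx hy => simp [hx, hy]

lemma im_baseChangeEquiv_map :
    (baseChangeEquiv a b B (Algebra.TensorProduct.map f (AlgHom.id F _) x)).im =
      f (baseChangeEquiv a b A x).im := by
  induction x with
  | zero => simp
  | tmul x z => simp
  | add x y hx hy => simp [hx, hy]

end Naturality

lemma algebraNorm_eq_norm (z : QuadraticAlgebra F a b) : Algebra.norm F z = norm z := by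
  rw [← det_toLinearMap_eq_norm]
  rfl

lemma algebraNorm_eq_norm_baseChangeEquiv {A : Type*} [CommRing A] [Algebra F A]
    (x : A ⊗[F] QuadraticAlgebra F a b) :
    Algebra.norm A x = norm (baseChangeEquiv a b A x) := by
  rw [← algebraNorm_eq_norm]
  exact (Algebra.norm_eq_of_algEquiv (baseChangeEquiv a b A) x).symm

variable (a b) in
/-- The canonical involution of a quadratic algebra, as an algebra homomorphism. -/
def conj : QuadraticAlgebra F a b →ₐ[F] QuadraticAlgebra F a b where
  __ := starRingAut (R := QuadraticAlgebra F a b)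
  map_one' := map_one (starRingAut (R := QuadraticAlgebra F a b))
  map_zero' := map_zero (starRingAut (R := QuadraticAlgebra F a b))
  commutes' r := by
    change star (algebraMap F (QuadraticAlgebra F a b) r) = _
    ext <;> simp

@[simp]
lemma conj_apply (z : QuadraticAlgebra F a b) : conj a b z = star z := rfl

lemma baseChangeEquiv_map_conj {A : Type*} [CommRing A] [Algebra F A]
    (x : A ⊗[F] QuadraticAlgebra F a b) :
    baseChangeEquiv a b A (Algebra.TensorProduct.map (AlgHom.id F A) (conj a b) x) =
      star (baseChangeEquiv a b A x) := by
  induction x with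
  | zero => simp
  | tmul x z => ext <;> simp; ring
  | add x y hx hy => simp [hx, hy]

lemma mul_map_conj_eq_one_iff {A : Type*} [CommRing A] [Algebra F A]
    (x : A ⊗[F] QuadraticAlgebra F a b) :
    x * Algebra.TensorProduct.map (AlgHom.id F A) (conj a b) x = 1 ↔ Algebra.norm A x = 1 := by
  rw [algebraNorm_eq_norm_baseChangeEquiv, norm_eq_one_iff_mem_unitary,
    Unitary.mem_iff_self_mul_star, ← baseChangeEquiv_map_conj, ← map_mul,
    EmbeddingLike.map_eq_one_iff]

section NormOne

variable (a b) in
/-- The group of norm-one units of a quadratic algebra. -/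
abbrev normOneUnits : Subgroup (QuadraticAlgebra F a b)ˣ := (Units.map norm).ker

lemma mem_normOneUnits {g : (QuadraticAlgebra F a b)ˣ} :
    g ∈ normOneUnits a b ↔ norm (g : QuadraticAlgebra F a b) = 1 := by
  rw [MonoidHom.mem_ker, Units.ext_iff]
  rfl

/-- An element of norm one, as a unit. -/
def normOneUnits.mk (z : QuadraticAlgebra F a b) (hz : norm z = 1) : normOneUnits a b :=
  ⟨⟨z, star z, by rw [← algebraMap_norm_eq_mul_star, hz, map_one],
    by rw [mul_comm, ← algebraMap_norm_eq_mul_star, hz, map_one]⟩, mem_normOneUnits.2 hz⟩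

@[simp]
lemma normOneUnits.mk_coe_val (z : QuadraticAlgebra F a b) (hz : norm z = 1) :
    ((normOneUnits.mk z hz).1 : QuadraticAlgebra F a b) = z := rfl

variable {r s : F}

lemma norm_eq_of_roots (hb : b = r + s) (ha : a = -(r * s)) (z : QuadraticAlgebra F a b) :
    norm z = (z.re + z.im * r) * (z.re + z.im * s) := by
  subst hb ha
  rw [norm_def]
  ring

/-- Evaluation of a quadratic algebra at a root of its polynomial `X ^ 2 - b X - a`. -/
def evalRoot (hb : b = r + s) (ha : a = -(r * s)) : QuadraticAlgebra F a b →ₐ[F] F :=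
  QuadraticAlgebra.lift ⟨r, by subst hb ha; simp; ring⟩

lemma evalRoot_apply (hb : b = r + s) (ha : a = -(r * s)) (z : QuadraticAlgebra F a b) :
    evalRoot hb ha z = z.re + z.im * r := by
  simp [evalRoot]

/-- If `X ^ 2 - b X - a = (X - r) (X - s)` with `r - s` invertible, then the norm-one units are
identified with `Fˣ` by evaluation at `r`. -/
noncomputable def normOneUnitsEquivUnits (hb : b = r + s) (ha : a = -(r * s))
    (hrs : IsUnit (r - s)) : normOneUnits a b ≃* Fˣ :=
  MulEquiv.ofBijective ((Units.map (evalRoot hb ha : _ →* F)).comp (Subgroup.subtype _)) <| by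
    obtain ⟨d, hd⟩ := hrs.exists_left_inv
    constructor
    · refine (injective_iff_map_eq_one _).2 fun g hg => ?_
      have h1 : (g.1 : QuadraticAlgebra F a b).re + (g.1 : QuadraticAlgebra F a b).im * r = 1 :=
        (evalRoot_apply hb ha g.1).symm.trans (congrArg Units.val hg)
      have h2 := mem_normOneUnits.1 g.2
      rw [norm_eq_of_roots hb ha, h1, one_mul] at h2
      have him : (g.1 : QuadraticAlgebra F a b).im = 0 := by
        linear_combination d * (h1 - h2) - (g.1 : QuadraticAlgebra F a b).im * hd
      rw [him, zero_mul, add_zero] at h1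
      exact Subtype.ext (Units.ext (QuadraticAlgebra.ext h1 him))
    · intro c
      have hc : (c : F) * (c⁻¹ : Fˣ) = 1 := c.mul_inv
      -- the element with values `c` at `r` and `c⁻¹` at `s`
      let z : QuadraticAlgebra F a b :=
        ⟨c - d * (c - (c⁻¹ : Fˣ)) * r, d * (c - (c⁻¹ : Fˣ))⟩
      have hr : z.re + z.im * r = c := by simp only [z]; ring
      have hs : z.re + z.im * s = (c⁻¹ : Fˣ) := by
        simp only [z]
        linear_combination ((c⁻¹ : Fˣ) - c : F) * hd
      refine ⟨normOneUnits.mk z (by rw [norm_eq_of_roots hb ha, hr, hs, hc]), Units.ext ?_⟩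
      exact (evalRoot_apply hb ha z).trans hr

@[simp]
lemma normOneUnitsEquivUnits_apply (hb : b = r + s) (ha : a = -(r * s)) (hrs : IsUnit (r - s))
    (g : normOneUnits a b) : (normOneUnitsEquivUnits hb ha hrs g : F) =
      (g.1 : QuadraticAlgebra F a b).re + (g.1 : QuadraticAlgebra F a b).im * r :=
  evalRoot_apply hb ha g.1

lemma evalRoot_sq (hb : b = r + r) (ha : a = -(r * r)) (g : normOneUnits a b) :
    evalRoot hb ha g.1 ^ 2 = 1 := by
  rw [← mem_normOneUnits.1 g.2, norm_eq_of_roots hb ha, evalRoot_apply, sq]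

/-- If `X ^ 2 - b X - a = (X - r) ^ 2`, so that the quadratic algebra is generated by
`ε = ω - r` with `ε ^ 2 = 0`, then the norm-one units are the elements `u + v ε` with `u ^ 2 = 1`,
and `u + v ε ↦ (u v, u)` identifies them with `F × μ₂(F)`. -/
def normOneUnitsEquivProd (hb : b = r + r) (ha : a = -(r * r)) :
    normOneUnits a b ≃* Multiplicative F × rootsOfUnity 2 F where
  toFun g := (Multiplicative.ofAdd (evalRoot hb ha g.1 * (g.1 : QuadraticAlgebra F a b).im),
    ⟨Units.map (evalRoot hb ha : _ →* F) g.1,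
      (mem_rootsOfUnity _ _).2 (Units.ext <| by simpa using evalRoot_sq hb ha g)⟩)
  invFun x := normOneUnits.mk ⟨(x.2.1 : F) - x.2.1 * x.1.toAdd * r, x.2.1 * x.1.toAdd⟩ (by
    have := congrArg Units.val ((mem_rootsOfUnity _ _).1 x.2.2)
    rw [Units.val_pow_eq_pow_val, Units.val_one] at this
    rw [norm_eq_of_roots hb ha, ← this]
    ring)
  left_inv g := by
    have h := evalRoot_sq hb ha g
    rw [evalRoot_apply] at h
    refine Subtype.ext (Units.ext (QuadraticAlgebra.ext ?_ ?_)) <;>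
      simp only [normOneUnits.mk_coe_val, Units.coe_map, MonoidHom.coe_coe, evalRoot_apply,
        toAdd_ofAdd]
    · linear_combination -(g.1 : QuadraticAlgebra F a b).im * r * h
    · linear_combination (g.1 : QuadraticAlgebra F a b).im * h
  right_inv x := by
    have h := congrArg Units.val ((mem_rootsOfUnity _ _).1 x.2.2)
    rw [Units.val_pow_eq_pow_val, Units.val_one] at h
    refine Prod.ext (Multiplicative.toAdd.injective ?_) (Subtype.ext (Units.ext ?_)) <;>
      simp only [normOneUnits.mk_coe_val, Units.coe_map, MonoidHom.coe_coe, evalRoot_apply,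
        toAdd_ofAdd]
    · linear_combination x.1.toAdd * h
    · ring
  map_mul' g h := by
    have hg := evalRoot_sq hb ha g
    have hh := evalRoot_sq hb ha h
    rw [evalRoot_apply] at hg hh
    refine Prod.ext (Multiplicative.toAdd.injective ?_) (Subtype.ext (Units.ext ?_))
    · simp only [Subgroup.coe_mul, Units.val_mul, map_mul, im_mul, evalRoot_apply, Prod.fst_mul,
        toAdd_mul, toAdd_ofAdd]
      generalize (g.1 : QuadraticAlgebra F a b).re = x at *
      generalize (g.1 : QuadraticAlgebra F a b).im = y at *
      generalize (h.1 : QuadraticAlgebra F a b).re = x' at *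
      generalize (h.1 : QuadraticAlgebra F a b).im = y' at *
      rw [hb]
      linear_combination (x' + y' * r) * y' * hg + (x + y * r) * y * hh
    · exact map_mul (evalRoot hb ha) _ _

lemma normOneUnitsEquivProd_apply_fst (hb : b = r + r) (ha : a = -(r * r))
    (g : normOneUnits a b) : (normOneUnitsEquivProd hb ha g).1.toAdd =
      ((g.1 : QuadraticAlgebra F a b).re + (g.1 : QuadraticAlgebra F a b).im * r) *
        (g.1 : QuadraticAlgebra F a b).im :=
  congrArg (· * _) (evalRoot_apply hb ha g.1)

lemma normOneUnitsEquivProd_apply_snd (hb : b = r + r) (ha : a = -(r * r))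
    (g : normOneUnits a b) : ((normOneUnitsEquivProd hb ha g).2.1 : F) =
      (g.1 : QuadraticAlgebra F a b).re + (g.1 : QuadraticAlgebra F a b).im * r :=
  evalRoot_apply hb ha g.1

end NormOne

end QuadraticAlgebra

lemma mem_normOneTorus_iff {R S A : Type u} [CommRing R] [CommRing S] [Algebra R S]
    [CommRing A] [Algebra R A] {g : (A ⊗[R] S)ˣ} :
    g ∈ (Units.map (Algebra.norm A : A ⊗[R] S →* A)).ker ↔ Algebra.norm A (g : A ⊗[R] S) = 1 := by
  rw [MonoidHom.mem_ker, Units.ext_iff]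
  rfl

section

open QuadraticAlgebra

variable {F : Type u} [CommRing F] (a b : F)

/-- The points of the norm-one torus of a quadratic algebra. -/
noncomputable def normOneTorusEquiv (A : CommAlgCat.{u} F) :
    (normOneTorus F (QuadraticAlgebra F a b)).obj A ≃*
      normOneUnits (algebraMap F A a) (algebraMap F A b) :=
  (Units.mapEquiv (baseChangeEquiv a b A : _ ≃* _)).equivOfMemIff fun g => by
    rw [mem_normOneTorus_iff, mem_normOneUnits, algebraNorm_eq_norm_baseChangeEquiv]
    rfl

variable {a b} {r s : F}

lemma re_normOneTorusEquiv_map {A B : CommAlgCat.{u} F} (f : A ⟶ B)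
    (x : (normOneTorus F (QuadraticAlgebra F a b)).obj A) :
    (normOneTorusEquiv a b B ((normOneTorus F (QuadraticAlgebra F a b)).map f x)).1.1.re =
      f.hom (normOneTorusEquiv a b A x).1.1.re :=
  re_baseChangeEquiv_map f.hom x.1.1

lemma im_normOneTorusEquiv_map {A B : CommAlgCat.{u} F} (f : A ⟶ B)
    (x : (normOneTorus F (QuadraticAlgebra F a b)).obj A) :
    (normOneTorusEquiv a b B ((normOneTorus F (QuadraticAlgebra F a b)).map f x)).1.1.im =
      f.hom (normOneTorusEquiv a b A x).1.1.im :=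
  im_baseChangeEquiv_map f.hom x.1.1

/-- The norm-one torus of a quadratic algebra which is split by an étale polynomial is `𝔾ₘ`. -/
noncomputable def normOneTorusIsoMultiplicativeGroup (hb : b = r + s) (ha : a = -(r * s))
    (hrs : IsUnit (r - s)) :
    normOneTorus F (QuadraticAlgebra F a b) ≅ multiplicativeGroup F :=
  NatIso.ofComponents (fun A => ((normOneTorusEquiv a b A).trans
      (normOneUnitsEquivUnits (r := algebraMap F A r) (s := algebraMap F A s)
        (by rw [hb, map_add]) (by rw [ha, map_neg, map_mul])
        (by rw [← map_sub]; exact hrs.map _))).toGrpIso)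
    (fun {A B} f => by
      ext x
      have h (A : CommAlgCat.{u} F) (y) := normOneUnitsEquivUnits_apply (F := A)
        (r := algebraMap F A r) (s := algebraMap F A s) (by rw [hb, map_add])
        (by rw [ha, map_neg, map_mul]) (by rw [← map_sub]; exact hrs.map _)
        (normOneTorusEquiv a b A y)
      refine Units.ext ((h B ((normOneTorus F _).map f x)).trans
        (Eq.trans ?_ (congrArg f.hom (h A x)).symm))
      rw [map_add, map_mul, AlgHom.commutes, re_normOneTorusEquiv_map f x,
          im_normOneTorusEquiv_map f x])

/-- The norm-one torus of a quadratic algebra given by a polynomial with a double root is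
`𝔾ₐ × μ₂`. -/
noncomputable def normOneTorusIsoAdditiveTimesMuTwo (hb : b = r + r) (ha : a = -(r * r)) :
    normOneTorus F (QuadraticAlgebra F a b) ≅ additiveTimesMuTwo F :=
  NatIso.ofComponents (fun A => ((normOneTorusEquiv a b A).trans
      (normOneUnitsEquivProd (r := algebraMap F A r)
        (by rw [hb, map_add]) (by rw [ha, map_neg, map_mul]))).toGrpIso)
    (fun {A B} f => by
      ext x
      have hb' (A : CommAlgCat.{u} F) : algebraMap F A b = algebraMap F A r + algebraMap F A r := by
        rw [hb, map_add]
      have ha' (A : CommAlgCat.{u} F) :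
          algebraMap F A a = -(algebraMap F A r * algebraMap F A r) := by
        rw [ha, map_neg, map_mul]
      have h₁ (A : CommAlgCat.{u} F) (y) :=
        normOneUnitsEquivProd_apply_fst (hb' A) (ha' A) (normOneTorusEquiv a b A y)
      have h₂ (A : CommAlgCat.{u} F) (y) :=
        normOneUnitsEquivProd_apply_snd (hb' A) (ha' A) (normOneTorusEquiv a b A y)
      let y := normOneUnitsEquivProd (hb' A) (ha' A) (normOneTorusEquiv a b A x)
      let z := normOneUnitsEquivProd (hb' B) (ha' B)
        (normOneTorusEquiv a b B ((normOneTorus F _).map f x))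
      have hre := re_normOneTorusEquiv_map f x
      have him := im_normOneTorusEquiv_map f x
      have h (u v : A) :
          f.hom u + f.hom v * algebraMap F B r = f.hom (u + v * algebraMap F A r) := by
        rw [map_add, map_mul, AlgHom.commutes]
      have e₂ : (z.2.1 : B) = f.hom y.2.1 :=
        (h₂ B _).trans ((congrArg₂ (fun u v => u + v * algebraMap F B r) hre him).trans
          ((h _ _).trans (congrArg f.hom (h₂ A x).symm)))
      have e₁ : z.1.toAdd = f.hom y.1.toAdd :=
        (h₁ B _).trans ((congrArg₂ (fun u v => (u + v * algebraMap F B r) * v) hre him).trans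
          ((congrArg (· * _) (h _ _)).trans
            ((map_mul f.hom _ _).symm.trans (congrArg f.hom (h₁ A x).symm))))
      have e : z = MonoidHom.prodMap (AddMonoidHom.toMultiplicative (f.hom : A →+ B))
          (restrictRootsOfUnity f.hom 2) y :=
        Prod.ext (Multiplicative.toAdd.injective e₁) (Subtype.ext (Units.ext e₂))
      exact e)

end

/-- The norm-one torus depends only on the isomorphism class of the algebra. -/
noncomputable def normOneTorusCongr {R S S' : Type u} [CommRing R] [CommRing S] [Algebra R S]
    [Module.Free R S] [Module.Finite R S] [CommRing S'] [Algebra R S'] [Module.Free R S']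
    [Module.Finite R S'] (e : S ≃ₐ[R] S') : normOneTorus R S ≅ normOneTorus R S' :=
  NatIso.ofComponents (fun A => MulEquiv.toGrpIso
      ((Units.mapEquiv (Algebra.TensorProduct.congr (AlgEquiv.refl (R := A) (A₁ := A)) e :
        A ⊗[R] S ≃* A ⊗[R] S')).equivOfMemIff fun g => by
          rw [mem_normOneTorus_iff, mem_normOneTorus_iff]
          exact Eq.congr_left (Algebra.norm_eq_of_algEquiv _ _).symm))
    (fun {A B} f => by
      ext x
      refine Subtype.ext (Units.ext ?_)
      change Algebra.TensorProduct.congr AlgEquiv.refl e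
        (Algebra.TensorProduct.map f.hom (AlgHom.id R S) x.1.1) =
          Algebra.TensorProduct.map f.hom (AlgHom.id R S')
            (Algebra.TensorProduct.congr AlgEquiv.refl e x.1.1)
      induction (x.1.1 : A ⊗[R] S) with
      | zero => simp
      | tmul y s => simp
      | add y z hy hz => simp only [map_add, hy, hz])

/-! ### The norm-one group in quadratic coordinates -/

section Coordinates

open QuadraticAlgebra

variable {R F S : Type*} [CommRing R] [CommRing F] [Algebra R F] [CommRing S] [Algebra R S]
  {a b : F} (e : F ⊗[R] S ≃ₐ[F] QuadraticAlgebra F a b)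

/-- Quadratic coordinates on `F ⊗ S` give quadratic coordinates on `A ⊗ S` for every `F`-algebra
`A`. -/
noncomputable def coordinatesBaseChange (A : Type*) [CommRing A] [Algebra R A] [Algebra F A]
    [IsScalarTower R F A] : A ⊗[R] S ≃ₐ[A] A ⊗[F] QuadraticAlgebra F a b :=
  (Algebra.TensorProduct.cancelBaseChange R F A A S).symm.trans
    (Algebra.TensorProduct.congr AlgEquiv.refl e)

@[simp]
lemma coordinatesBaseChange_tmul (A : Type*) [CommRing A] [Algebra R A] [Algebra F A]
    [IsScalarTower R F A] (x : A) (s : S) :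
    coordinatesBaseChange e A (x ⊗ₜ s) = x ⊗ₜ e (1 ⊗ₜ s) := by
  simp [coordinatesBaseChange]

lemma coordinatesBaseChange_map {A B : Type*} [CommRing A] [Algebra R A] [Algebra F A]
    [IsScalarTower R F A] [CommRing B] [Algebra R B] [Algebra F B] [IsScalarTower R F B]
    (f : A →ₐ[F] B) (x : A ⊗[R] S) :
    coordinatesBaseChange e B
        (Algebra.TensorProduct.map (f.restrictScalars R) (AlgHom.id R S) x) =
      Algebra.TensorProduct.map f (AlgHom.id F _) (coordinatesBaseChange e A x) := by
  induction x with
  | zero => simp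
  | tmul x s => simp
  | add x y hx hy => simp only [map_add, hx, hy]

variable {e} {σ : S →ₐ[R] S}

lemma coordinatesBaseChange_conj
    (he : ∀ s : S, e (1 ⊗ₜ σ s) = star (e (1 ⊗ₜ s))) (A : Type*) [CommRing A]
    [Algebra R A] [Algebra F A] [IsScalarTower R F A] (x : A ⊗[R] S) :
    coordinatesBaseChange e A (Algebra.TensorProduct.map (AlgHom.id R A) σ x) =
      Algebra.TensorProduct.map (AlgHom.id F A) (conj a b) (coordinatesBaseChange e A x) := by
  induction x with
  | zero => simp
  | tmul x s => simp [he]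
  | add x y hx hy => simp only [map_add, hx, hy]

lemma mul_conj_eq_one_iff_norm_coordinates
    (he : ∀ s : S, e (1 ⊗ₜ σ s) = star (e (1 ⊗ₜ s))) (A : Type*) [CommRing A]
    [Algebra R A] [Algebra F A] [IsScalarTower R F A] (x : A ⊗[R] S) :
    x * Algebra.TensorProduct.map (AlgHom.id R A) σ x = 1 ↔
      Algebra.norm A (coordinatesBaseChange e A x) = 1 := by
  rw [← mul_map_conj_eq_one_iff, ← coordinatesBaseChange_conj he, ← map_mul,
    EmbeddingLike.map_eq_one_iff]

end Coordinates

section Integral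

variable {k L : Type u} [Field k] [Field L] [NumberField k] [NumberField L] [Algebra k L]

lemma mem_ker_integralGaloisNorm_iff {A : Type u} [CommRing A] [Algebra (𝓞 k) A]
    {g : (A ⊗[𝓞 k] 𝓞 L)ˣ} : g ∈ (Units.map (integralGaloisNorm k L A)).ker ↔
      integralGaloisNorm k L A (g : A ⊗[𝓞 k] 𝓞 L) = 1 := by
  rw [MonoidHom.mem_ker, Units.ext_iff]
  rfl

/-- The norm over every `𝓞 k`-algebra `A` is the product of the identity and of the base change of
`σ`; so `σ` is the non-trivial automorphism of a quadratic extension. -/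
abbrev InducesGaloisNorm (σ : 𝓞 L →ₐ[𝓞 k] 𝓞 L) : Prop :=
  ∀ (A : Type u) [CommRing A] [Algebra (𝓞 k) A] (x : A ⊗[𝓞 k] 𝓞 L),
    integralGaloisNorm k L A x = x * Algebra.TensorProduct.map (AlgHom.id (𝓞 k) A) σ x

variable {σ : 𝓞 L →ₐ[𝓞 k] 𝓞 L}

lemma mem_ker_integralGaloisNorm_iff_coordinates (hσ : InducesGaloisNorm σ)
    {F A : Type u} [CommRing F] [Algebra (𝓞 k) F]
    [CommRing A] [Algebra (𝓞 k) A] [Algebra F A] [IsScalarTower (𝓞 k) F A]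
    {a b : F} (e : F ⊗[𝓞 k] 𝓞 L ≃ₐ[F] QuadraticAlgebra F a b)
    (he : ∀ s : 𝓞 L, e (1 ⊗ₜ σ s) = star (e (1 ⊗ₜ s))) (g : (A ⊗[𝓞 k] 𝓞 L)ˣ) :
    g ∈ (Units.map (integralGaloisNorm k L A)).ker ↔
      Units.mapEquiv (coordinatesBaseChange e A : A ⊗[𝓞 k] 𝓞 L ≃* A ⊗[F] QuadraticAlgebra F a b) g ∈
        (Units.map (Algebra.norm A : A ⊗[F] QuadraticAlgebra F a b →* A)).ker := by
  rw [mem_ker_integralGaloisNorm_iff, mem_normOneTorus_iff, hσ,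
    mul_conj_eq_one_iff_norm_coordinates he]
  rfl

/-- In quadratic coordinates over an `𝓞 k`-algebra `F`, the norm-one group over `F` becomes the
norm-one torus of the quadratic algebra. -/
noncomputable def restrictScalarsIsoNormOneTorus (hσ : InducesGaloisNorm σ)
    {F : Type u} [CommRing F] [Algebra (𝓞 k) F]
    {a b : F} (e : F ⊗[𝓞 k] 𝓞 L ≃ₐ[F] QuadraticAlgebra F a b)
    (he : ∀ s : 𝓞 L, e (1 ⊗ₜ σ s) = star (e (1 ⊗ₜ s))) :
    CommAlgCat.restrictScalars (𝓞 k) F ⋙ integralNormOneGroup k L ≅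
      normOneTorus F (QuadraticAlgebra F a b) :=
  NatIso.ofComponents (fun A =>
      letI : Algebra (𝓞 k) A := Algebra.compHom A (algebraMap (𝓞 k) F)
      haveI : IsScalarTower (𝓞 k) F A := .of_algebraMap_eq fun _ => rfl
      MulEquiv.toGrpIso <|
        (Units.mapEquiv (coordinatesBaseChange e A :
          A ⊗[𝓞 k] 𝓞 L ≃* A ⊗[F] QuadraticAlgebra F a b)).equivOfMemIff
            (mem_ker_integralGaloisNorm_iff_coordinates hσ (A := A) e he))
    (fun {A B} f => by
      let _ : Algebra (𝓞 k) A := Algebra.compHom A (algebraMap (𝓞 k) F)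
      let _ : Algebra (𝓞 k) B := Algebra.compHom B (algebraMap (𝓞 k) F)
      have hA : IsScalarTower (𝓞 k) F A := .of_algebraMap_eq fun _ => rfl
      have hB : IsScalarTower (𝓞 k) F B := .of_algebraMap_eq fun _ => rfl
      ext x
      have h := coordinatesBaseChange_map (A := A) (B := B) e f.hom
      exact Subtype.ext (Units.ext (h x.1.1)))

end Integral

/-! ### Existence of quadratic coordinates -/

section Local

/-- Over a local ring, the unit element of a free algebra of rank two is part of a basis. -/
lemma IsLocalRing.exists_basis_fin_two {F B : Type*} [CommRing F] [IsLocalRing F] [CommRing B]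
    [Algebra F B] [Module.Finite F B] [Module.Free F B] (h : Module.finrank F B = 2) :
    ∃ v : Module.Basis (Fin 2) F B, v 0 = 1 := by
  let κ := IsLocalRing.ResidueField F
  have hκ : Module.finrank κ (κ ⊗[F] B) = 2 := by rw [Module.finrank_baseChange, h]
  have : Nontrivial (κ ⊗[F] B) := Module.nontrivial_of_finrank_pos (R := κ) (by omega)
  obtain ⟨w', hw'⟩ : ∃ w' : κ ⊗[F] B, w' ∉ Submodule.span κ {1} := by
    by_contra! hall
    have := finrank_span_singleton (K := κ) (one_ne_zero (α := κ ⊗[F] B))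
    rw [(Submodule.eq_top_iff'.2 hall), finrank_top] at this
    omega
  obtain ⟨w, rfl⟩ := TensorProduct.mk_surjective F B κ (IsLocalRing.residue_surjective) w'
  have hli : LinearIndependent κ (TensorProduct.mk F κ B 1 ∘ ![1, w]) := by
    have h : LinearIndependent κ ![(1 : κ ⊗[F] B), 1 ⊗ₜ w] := by
      refine (LinearIndependent.pair_iff' one_ne_zero).2 fun c hc => hw' ?_
      exact Submodule.mem_span_singleton.2 ⟨c, hc⟩
    convert h using 1
    ext i
    fin_cases i <;> rfl
  have := Module.finitePresentation_of_projective F B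
  obtain ⟨v, hv⟩ := Module.exists_basis_of_basis_baseChange ![1, w] hli
    (hli.span_eq_top_of_card_eq_finrank (by simp [κ, hκ]))
    (Module.Flat.rTensor_preserves_injective_linearMap _ Subtype.val_injective)
  exact ⟨v, by simp [hv]⟩

open QuadraticAlgebra

/-- A rank two algebra with basis `1, w` and an involution with `w + τ w = b` and `w τ w = -a` is a
quadratic algebra, with its canonical involution. -/
lemma exists_algEquiv_quadraticAlgebra {F B : Type*} [CommRing F] [CommRing B] [Algebra F B]
    (v : Module.Basis (Fin 2) F B) (hv : v 0 = 1) {τ : B →ₐ[F] B}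
    (htr : ∀ x, ∃ t, x + τ x = algebraMap F B t) (hn : ∀ x, ∃ n, x * τ x = algebraMap F B n) :
    ∃ (a b : F) (e : B ≃ₐ[F] QuadraticAlgebra F a b), ∀ x, e (τ x) = star (e x) := by
  obtain ⟨b, hb⟩ := htr (v 1)
  obtain ⟨n, hn⟩ := hn (v 1)
  let f : QuadraticAlgebra F (-n) b →ₐ[F] B := QuadraticAlgebra.lift ⟨v 1, by
    rw [Algebra.smul_def, Algebra.smul_def, map_neg, ← hn, ← hb]
    ring⟩
  have hf : ⇑f = v.equivFun.symm ∘ linearEquivTuple (-n) b := by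
    ext z
    simp [f, hv, linearEquivTuple_apply]
  have hf' : Function.Bijective f := by
    rw [hf]
    exact v.equivFun.symm.bijective.comp (LinearEquiv.bijective _)
  let e := AlgEquiv.ofBijective f hf'
  refine ⟨-n, b, e.symm, fun x => ?_⟩
  obtain ⟨z, rfl⟩ := e.surjective x
  rw [AlgEquiv.symm_apply_apply, AlgEquiv.symm_apply_eq]
  have : τ.comp f = f.comp (conj (-n) b) := algHom_ext (by
    have : star (omega : QuadraticAlgebra F (-n) b) = algebraMap F _ b - omega := by
      ext <;> simp
    rw [AlgHom.comp_apply, AlgHom.comp_apply, conj_apply, this, map_sub, AlgHom.commutes, ← hb]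
    simp [f])
  exact DFunLike.congr_fun this z

variable {R S : Type*} [CommRing R] [CommRing S] [Algebra R S] {σ : S →ₐ[R] S}

lemma baseChange_trace_mem (htr : ∀ x, ∃ t, x + σ x = algebraMap R S t) (F : Type*) [CommRing F]
    [Algebra R F] (x : F ⊗[R] S) :
    ∃ t, x + Algebra.TensorProduct.map (AlgHom.id F F) σ x = algebraMap F (F ⊗[R] S) t := by
  induction x with
  | zero => exact ⟨0, by simp⟩
  | tmul c s =>
    obtain ⟨t, ht⟩ := htr s
    refine ⟨c * algebraMap R F t, ?_⟩
    rw [Algebra.TensorProduct.map_tmul, AlgHom.id_apply, ← TensorProduct.tmul_add, ht,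
      Algebra.algebraMap_eq_smul_one t, TensorProduct.tmul_smul, TensorProduct.smul_tmul',
      Algebra.smul_def, mul_comm]
    rfl
  | add x y hx hy =>
    obtain ⟨t, ht⟩ := hx
    obtain ⟨t', ht'⟩ := hy
    exact ⟨t + t', by rw [map_add, map_add, ← ht, ← ht']; ring⟩

lemma map_conj_map_conj (hσ : ∀ x, σ (σ x) = x) {F : Type*} [CommRing F] [Algebra R F]
    (x : F ⊗[R] S) : Algebra.TensorProduct.map (AlgHom.id F F) σ
      (Algebra.TensorProduct.map (AlgHom.id F F) σ x) = x := by
  induction x with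
  | zero => simp
  | tmul c s => simp [hσ]
  | add y z hy hz => simp only [map_add, hy, hz]

lemma baseChange_norm_mem (htr : ∀ x, ∃ t, x + σ x = algebraMap R S t)
    (hn : ∀ x, ∃ n, x * σ x = algebraMap R S n) (hσ : ∀ x, σ (σ x) = x) (F : Type*) [CommRing F]
    [Algebra R F] (x : F ⊗[R] S) :
    ∃ n, x * Algebra.TensorProduct.map (AlgHom.id F F) σ x = algebraMap F (F ⊗[R] S) n := by
  induction x with
  | zero => exact ⟨0, by simp⟩
  | tmul c s =>
    obtain ⟨n, h⟩ := hn s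
    refine ⟨c * c * algebraMap R F n, ?_⟩
    rw [Algebra.TensorProduct.map_tmul, AlgHom.id_apply, Algebra.TensorProduct.tmul_mul_tmul, h,
      Algebra.algebraMap_eq_smul_one n, TensorProduct.tmul_smul, TensorProduct.smul_tmul',
      Algebra.smul_def, mul_comm]
    rfl
  | add x y hx hy =>
    obtain ⟨n, h⟩ := hx
    obtain ⟨n', h'⟩ := hy
    obtain ⟨t, ht⟩ := baseChange_trace_mem htr F
      (x * Algebra.TensorProduct.map (AlgHom.id F F) σ y)
    rw [map_mul, map_conj_map_conj hσ] at ht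
    refine ⟨n + n' + t, ?_⟩
    rw [map_add, map_add, map_add, ← h, ← h', ← ht]
    ring

/-- Over every local `R`-algebra `F`, there is an isomorphism of `F ⊗ S` with a quadratic algebra
which turns `σ` into the canonical involution `star`. -/
abbrev HasQuadraticCoordinates {R S : Type u} [CommRing R] [CommRing S] [Algebra R S]
    (σ : S →ₐ[R] S) : Prop :=
  ∀ (F : Type u) [CommRing F] [Algebra R F] [IsLocalRing F],
    ∃ (a b : F) (e : F ⊗[R] S ≃ₐ[F] QuadraticAlgebra F a b),
      ∀ s, e (1 ⊗ₜ σ s) = star (e (1 ⊗ₜ s))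

/-- An algebra of rank two with a conjugation has quadratic coordinates over every local ring. -/
lemma hasQuadraticCoordinates {R S : Type u} [CommRing R] [CommRing S]
    [Algebra R S] {σ : S →ₐ[R] S} [Module.Finite R S] [Module.Flat R S]
    (hrank : ∀ p : PrimeSpectrum R, Module.rankAtStalk S p = 2) (hσ : ∀ x, σ (σ x) = x)
    (htr : ∀ x, ∃ t, x + σ x = algebraMap R S t) (hn : ∀ x, ∃ n, x * σ x = algebraMap R S n) :
    HasQuadraticCoordinates σ := by
  intro F _ _ _
  have : Module.Free F (F ⊗[R] S) := Module.free_of_flat_of_isLocalRing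
  have h2 : Module.finrank F (F ⊗[R] S) = 2 := by
    have p : PrimeSpectrum F := IsLocalRing.closedPoint F
    have := Module.rankAtStalk_baseChange (R := R) (M := S) p
    rw [hrank, Module.rankAtStalk_eq_finrank_of_free] at this
    exact this
  obtain ⟨v, hv⟩ := IsLocalRing.exists_basis_fin_two h2
  obtain ⟨a, b, e, he⟩ := exists_algEquiv_quadraticAlgebra v hv (baseChange_trace_mem htr F)
    (baseChange_norm_mem htr hn hσ F)
  exact ⟨a, b, e, fun s => by simpa using he (1 ⊗ₜ s)⟩

end Local

section Integral

variable (k L : Type u) [Field k] [Field L] [NumberField k] [NumberField L] [Algebra k L]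
  [Algebra.IsQuadraticExtension k L]

/-- The non-trivial automorphism of a quadratic extension of number fields, on the rings of
integers. -/
lemma exists_conj_ringOfIntegers : ∃ σ : 𝓞 L →ₐ[𝓞 k] 𝓞 L,
    InducesGaloisNorm σ ∧ (∀ x, σ (σ x) = x) ∧
    (∀ x, ∃ t, x + σ x = algebraMap (𝓞 k) (𝓞 L) t) ∧
    (∀ x, ∃ n, x * σ x = algebraMap (𝓞 k) (𝓞 L) n) := by
  classical
  have hcard : Fintype.card Gal(L/k) = 2 := by
    rw [← Nat.card_eq_fintype_card, IsGalois.card_aut_eq_finrank,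
      Algebra.IsQuadraticExtension.finrank_eq_two]
  obtain ⟨τ, hτ⟩ : ∃ τ : Gal(L/k), τ ≠ 1 := by
    have : Nontrivial Gal(L/k) := Fintype.one_lt_card_iff_nontrivial.1 (by omega)
    exact exists_ne 1
  have huniv : (Finset.univ : Finset Gal(L/k)) = {1, τ} :=
    (Finset.eq_univ_of_card _ (by rw [Finset.card_pair hτ.symm, hcard])).symm
  let σ : 𝓞 L →ₐ[𝓞 k] 𝓞 L := galRestrict (𝓞 k) k L (𝓞 L) τ
  have h1 (A : Type u) [CommRing A] [Algebra (𝓞 k) A] (x : A ⊗[𝓞 k] 𝓞 L) :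
      integralGaloisNorm k L A x = x * Algebra.TensorProduct.map (AlgHom.id (𝓞 k) A) σ x := by
    have h : (galRestrict (𝓞 k) k L (𝓞 L) (1 : Gal(L/k)) : 𝓞 L →ₐ[𝓞 k] 𝓞 L) =
        AlgHom.id _ _ := by
      rw [map_one]
      rfl
    rw [integralGaloisNorm, huniv, Finset.prod_pair hτ.symm, MonoidHom.mul_apply, h,
      Algebra.TensorProduct.map_id]
    rfl
  have hn (x) : ∃ n, x * σ x = algebraMap (𝓞 k) (𝓞 L) n := by
    refine ⟨RingOfIntegers.norm k x, RingOfIntegers.coe_injective ?_⟩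
    refine Eq.trans ?_ (RingOfIntegers.coe_algebraMap_norm k x).symm
    rw [Algebra.norm_eq_prod_automorphisms, huniv, Finset.prod_pair hτ.symm, map_mul,
      AlgEquiv.one_apply]
    exact congrArg _ (algebraMap_galRestrict_apply (𝓞 k) τ x)
  have htr (x) : ∃ t, x + σ x = algebraMap (𝓞 k) (𝓞 L) t := by
    obtain ⟨n, h⟩ := hn x
    -- the trace is obtained from norms: `x + σ x = N(1 + x) - 1 - N(x)`
    obtain ⟨n', h'⟩ := hn (1 + x)
    refine ⟨n' - 1 - n, ?_⟩
    rw [map_sub, map_sub, map_one, ← h, ← h', map_add, map_one]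
    ring
  refine ⟨σ, fun A => h1 A, fun x => ?_, htr, hn⟩
  obtain ⟨t, ht⟩ := htr x
  have := congrArg σ ht
  rw [map_add, AlgHom.commutes, ← ht] at this
  linear_combination this

/-- `𝓞 L` has rank two over `𝓞 k` at every prime: the rank is the one at the generic point. -/
lemma rankAtStalk_ringOfIntegers (p : PrimeSpectrum (𝓞 k)) :
    Module.rankAtStalk (𝓞 L) p = 2 := by
  rw [← Module.rankAtStalk_eq_of_le_of_finite_of_flat (𝓞 L) (bot_le : ⊥ ≤ p)]
  have hloc : IsLocalization (Algebra.algebraMapSubmonoid (𝓞 L) (nonZeroDivisors (𝓞 k))) L :=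
    IsIntegralClosure.isLocalization (𝓞 k) k L (𝓞 L)
  have hbc := (isLocalizedModule_iff_isBaseChange (nonZeroDivisors (𝓞 k)) k
    (IsScalarTower.toAlgHom (𝓞 k) (𝓞 L) L).toLinearMap).1
    (isLocalizedModule_iff_isLocalization.2 hloc)
  have hq : (⊥ : PrimeSpectrum k).comap (algebraMap (𝓞 k) k) = ⊥ :=
    PrimeSpectrum.ext ((Ideal.comap_bot_of_injective _ (RingOfIntegers.coe_injective)))
  rw [← hq, ← Module.rankAtStalk_isBaseChange hbc, Module.rankAtStalk_eq_finrank_of_free]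
  exact Algebra.IsQuadraticExtension.finrank_eq_two k L

end Integral

/-! ### The universal norm-one element -/

section Universal

lemma Algebra.TensorProduct.map_comp_id_apply {R S A B C : Type*} [CommRing R] [CommRing S]
    [Algebra R S] [CommRing A] [Algebra R A] [CommRing B] [Algebra R B] [CommRing C] [Algebra R C]
    (g : B →ₐ[R] C) (f : A →ₐ[R] B) (x : A ⊗[R] S) :
    Algebra.TensorProduct.map (g.comp f) (AlgHom.id R S) x =
      Algebra.TensorProduct.map g (AlgHom.id R S)
        (Algebra.TensorProduct.map f (AlgHom.id R S) x) := by
  induction x with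
  | zero => simp
  | tmul c s => simp
  | add y z hy hz => simp only [map_add, hy, hz]

lemma map_conj_map_id {R S A B : Type*} [CommRing R] [CommRing S]
    [Algebra R S] [CommRing A] [Algebra R A] [CommRing B] [Algebra R B] (σ : S →ₐ[R] S)
    (f : A →ₐ[R] B) (x : A ⊗[R] S) :
    Algebra.TensorProduct.map (AlgHom.id R B) σ
        (Algebra.TensorProduct.map f (AlgHom.id R S) x) =
      Algebra.TensorProduct.map f (AlgHom.id R S)
        (Algebra.TensorProduct.map (AlgHom.id R A) σ x) := by
  induction x with
  | zero => simp
  | tmul c s => simp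
  | add y z hy hz => simp only [map_add, hy, hz]

variable {R S : Type u} [CommRing R] [CommRing S] [Algebra R S]

/-- The element `u` of `H ⊗ S` is the universal element of norm one: it satisfies `u * σ u = 1`, and
every such element of `A ⊗ S`, for an `R`-algebra `A`, is the image of `u` under exactly one
homomorphism `H → A`. -/
structure IsUniversalNormOne (σ : S →ₐ[R] S) {H : Type u} [CommRing H] [Algebra R H]
    (u : H ⊗[R] S) : Prop where
  mul_conj : u * Algebra.TensorProduct.map (AlgHom.id R H) σ u = 1
  existsUnique (A : Type u) [CommRing A] [Algebra R A] (x : A ⊗[R] S) :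
    x * Algebra.TensorProduct.map (AlgHom.id R A) σ x = 1 →
      ∃! f : H →ₐ[R] A, Algebra.TensorProduct.map f (AlgHom.id R S) u = x

/-- The `A`-linear form on `A ⊗ S` induced by a linear form on `S`. -/
noncomputable def baseChangeForm (A : Type*) [CommRing A] [Algebra R A] (φ : S →ₗ[R] R) :
    A ⊗[R] S →ₗ[A] A :=
  (Algebra.TensorProduct.rid R A A).toLinearMap ∘ₗ φ.baseChange A

@[simp]
lemma baseChangeForm_tmul (A : Type*) [CommRing A] [Algebra R A] (φ : S →ₗ[R] R) (c : A) (s : S) :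
    baseChangeForm A φ (c ⊗ₜ s) = φ s • c := by
  simp [baseChangeForm]

lemma baseChangeForm_map {A B : Type*} [CommRing A] [Algebra R A] [CommRing B] [Algebra R B]
    (φ : S →ₗ[R] R) (f : A →ₐ[R] B) (x : A ⊗[R] S) :
    baseChangeForm B φ (Algebra.TensorProduct.map f (AlgHom.id R S) x) =
      f (baseChangeForm A φ x) := by
  induction x with
  | zero => simp
  | tmul c s => simp
  | add y z hy hz => simp only [map_add, hy, hz]

lemma sum_baseChangeForm_tmul {ι : Type*} [Fintype ι] {m : ι → S} {φ : ι → S →ₗ[R] R}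
    (h : ∀ s, ∑ i, φ i s • m i = s) (A : Type*) [CommRing A] [Algebra R A] (x : A ⊗[R] S) :
    ∑ i, baseChangeForm A (φ i) x ⊗ₜ[R] m i = x := by
  induction x with
  | zero => simp
  | tmul c s =>
    simp only [baseChangeForm_tmul, TensorProduct.smul_tmul, ← TensorProduct.tmul_sum, h]
  | add y z hy hz => simp only [map_add, TensorProduct.add_tmul, Finset.sum_add_distrib, hy, hz]

lemma baseChangeForm_ext {ι : Type*} [Fintype ι] {m : ι → S} {φ : ι → S →ₗ[R] R}
    (h : ∀ s, ∑ i, φ i s • m i = s) {A : Type*} [CommRing A] [Algebra R A] {x y : A ⊗[R] S}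
    (hxy : ∀ i, baseChangeForm A (φ i) x = baseChangeForm A (φ i) y) : x = y := by
  rw [← sum_baseChangeForm_tmul h A x, ← sum_baseChangeForm_tmul h A y]
  simp only [hxy]

lemma exists_dual_basis (R S : Type*) [CommRing R] [AddCommGroup S] [Module R S]
    [Module.Finite R S] [Module.Projective R S] :
    ∃ (n : ℕ) (m : Fin n → S) (φ : Fin n → S →ₗ[R] R), ∀ s, ∑ i, φ i s • m i = s := by
  obtain ⟨n, f, g, -, -, hfg⟩ := Module.Finite.exists_comp_eq_id_of_projective R S
  refine ⟨n, fun i => f (Pi.single i 1), fun i => LinearMap.proj i ∘ₗ g, fun s => ?_⟩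
  refine Eq.trans ?_ (DFunLike.congr_fun hfg s)
  rw [LinearMap.comp_apply]
  conv_rhs => rw [← Finset.univ_sum_single (g s)]
  rw [map_sum]
  refine Finset.sum_congr rfl fun i _ => ?_
  rw [LinearMap.comp_apply, LinearMap.proj_apply, ← map_smul, ← Pi.single_smul, smul_eq_mul,
    mul_one]

/-- If `S` is finite projective over `R`, there is a universal element of norm one. In terms of
generators `m i` of `S` with dual forms `φ i`, the algebra `H` is generated by the coordinates `X i`
of an element `X = ∑ X i ⊗ m i`, subject to the relations `φ i X = X i` and `X * σ X = 1`. -/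
lemma exists_isUniversalNormOne [Module.Finite R S] [Module.Projective R S] (σ : S →ₐ[R] S) :
    ∃ (H : Type u) (_ : CommRing H) (_ : Algebra R H) (u : H ⊗[R] S),
      Algebra.FinitePresentation R H ∧ IsUniversalNormOne σ u := by
  obtain ⟨n, m, φ, h⟩ := exists_dual_basis R S
  let P := MvPolynomial (Fin n) R
  let X : P ⊗[R] S := ∑ i, (MvPolynomial.X i : P) ⊗ₜ m i
  let rel : Fin n ⊕ Fin n → P := Sum.elim
    (fun i => baseChangeForm P (φ i) X - MvPolynomial.X i)
    (fun i => baseChangeForm P (φ i) (X * Algebra.TensorProduct.map (AlgHom.id R P) σ X) -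
      baseChangeForm P (φ i) 1)
  let I : Ideal P := Ideal.span (Set.range rel)
  let π : P →ₐ[R] P ⧸ I := Ideal.Quotient.mkₐ R I
  have hπ (j) : π (rel j) = 0 :=
    Ideal.Quotient.eq_zero_iff_mem.2 (Ideal.subset_span ⟨j, rfl⟩)
  have hπX (i) : π (baseChangeForm P (φ i) X) = π (MvPolynomial.X i) := by
    simpa [rel, sub_eq_zero] using hπ (.inl i)
  refine ⟨P ⧸ I, inferInstance, inferInstance, Algebra.TensorProduct.map π (AlgHom.id R S) X,
    Algebra.FinitePresentation.quotient ⟨(Set.finite_range rel).toFinset, by simp [I]⟩, ?_, ?_⟩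
  · refine baseChangeForm_ext h fun i => ?_
    rw [map_conj_map_id, ← map_mul, baseChangeForm_map,
      ← map_one (Algebra.TensorProduct.map π (AlgHom.id R S)), baseChangeForm_map]
    exact sub_eq_zero.1 ((map_sub π _ _).symm.trans (hπ (.inr i)))
  · intro A _ _ x hx
    let f : P →ₐ[R] A := MvPolynomial.aeval fun i => baseChangeForm A (φ i) x
    have hfX (i) : f (MvPolynomial.X i) = baseChangeForm A (φ i) x := MvPolynomial.aeval_X _ i
    have hf : Algebra.TensorProduct.map f (AlgHom.id R S) X = x := by
      simp only [X, map_sum, Algebra.TensorProduct.map_tmul, hfX, AlgHom.id_apply]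
      exact sum_baseChangeForm_tmul h A x
    have hI : ∀ y ∈ I, f y = 0 := by
      refine (Ideal.span_le (I := RingHom.ker f)).2 ?_
      rintro _ ⟨i | i, rfl⟩
      · simp only [SetLike.mem_coe, RingHom.mem_ker, rel, Sum.elim_inl, map_sub,
          ← baseChangeForm_map, hf, hfX, sub_self]
      · simp only [SetLike.mem_coe, RingHom.mem_ker, rel, Sum.elim_inr, map_sub,
          ← baseChangeForm_map, map_mul, ← map_conj_map_id, hf, hx, map_one, sub_self]
    refine ⟨Ideal.Quotient.liftₐ I f hI, ?_, fun g hg => ?_⟩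
    · beta_reduce
      rw [← Algebra.TensorProduct.map_comp_id_apply, Ideal.Quotient.liftₐ_comp]
      exact hf
    · refine Ideal.Quotient.algHom_ext _ (MvPolynomial.algHom_ext fun i => ?_)
      rw [Ideal.Quotient.liftₐ_comp]
      rw [hfX, ← hg, baseChangeForm_map, baseChangeForm_map]
      exact congrArg g (hπX i).symm

end Universal

section Integral

variable {k L : Type u} [Field k] [Field L] [NumberField k] [NumberField L] [Algebra k L]

/-- The algebra carrying the universal element of norm one corepresents the norm-one group. -/
noncomputable def IsUniversalNormOne.corepresentableBy {σ : 𝓞 L →ₐ[𝓞 k] 𝓞 L}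
    (hσ : InducesGaloisNorm σ)
    {H : Type u} [CommRing H] [Algebra (𝓞 k) H] {u : H ⊗[𝓞 k] 𝓞 L}
    (hu : IsUniversalNormOne σ u) :
    (integralNormOneGroup k L ⋙ forget GrpCat).CorepresentableBy (CommAlgCat.of (𝓞 k) H) :=
  let g : (H ⊗[𝓞 k] 𝓞 L)ˣ := .mkOfMulEqOne _ _ hu.mul_conj
  have hg : g ∈ (Units.map (integralGaloisNorm k L H)).ker :=
    mem_ker_integralGaloisNorm_iff.2 ((hσ H u).trans hu.mul_conj)
  { homEquiv := fun {A} => Equiv.ofBijective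
      (fun f => (integralNormOneGroup k L).map f ⟨g, hg⟩) <| by
        have key (f : CommAlgCat.of (𝓞 k) H ⟶ A)
            (x : (Units.map (integralGaloisNorm k L A)).ker) :
            (integralNormOneGroup k L).map f ⟨g, hg⟩ = x ↔
              Algebra.TensorProduct.map f.hom (AlgHom.id (𝓞 k) (𝓞 L)) u = x.1.1 :=
          Subtype.ext_iff.trans Units.ext_iff
        rw [Function.bijective_iff_existsUnique]
        intro x
        have hx := (hσ A _).symm.trans (mem_ker_integralGaloisNorm_iff.1 x.2)
        obtain ⟨f, hf, huniq⟩ := hu.existsUnique A _ hx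
        refine ⟨CommAlgCat.ofHom f, (key _ x).2 hf, fun f' hf' => ?_⟩
        exact CommAlgCat.hom_ext (huniq f'.hom ((key f' x).1 hf'))
    homEquiv_comp := fun {A B} f' f => by
      exact ConcreteCategory.congr_hom ((integralNormOneGroup k L).map_comp f f') _ }

end Integral

/-! ### Flatness -/

section Fibres

open QuadraticAlgebra

lemma QuadraticAlgebra.lift_omega {R A : Type*} [CommRing R] [CommRing A] [Algebra R A] {a b : R}
    (x : { x : A // x * x = a • 1 + b • x }) : QuadraticAlgebra.lift x omega = x.1 :=
  congrArg Subtype.val (QuadraticAlgebra.lift.symm_apply_apply x)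

variable {R S : Type u} [CommRing R] [CommRing S] [Algebra R S] {σ : S →ₐ[R] S}

section QuadraticCoordinates

variable {F : Type u} [CommRing F] [Algebra R F] {a b : F}
  (e : F ⊗[R] S ≃ₐ[F] QuadraticAlgebra F a b)

/-- Quadratic coordinates on `F ⊗ S` identify `A ⊗ S`, for an `F`-algebra `A`, with a quadratic
algebra over `A`. -/
noncomputable def quadraticCoordinates (A : Type u) [CommRing A] [Algebra R A] [Algebra F A]
    [IsScalarTower R F A] :
    A ⊗[R] S ≃ₐ[A] QuadraticAlgebra A (algebraMap F A a) (algebraMap F A b) :=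
  (coordinatesBaseChange e A).trans (baseChangeEquiv a b A)

lemma re_quadraticCoordinates_map {A B : Type u} [CommRing A] [Algebra R A] [Algebra F A]
    [IsScalarTower R F A] [CommRing B] [Algebra R B] [Algebra F B] [IsScalarTower R F B]
    (f : A →ₐ[F] B) (x : A ⊗[R] S) :
    (quadraticCoordinates e B
      (Algebra.TensorProduct.map (f.restrictScalars R) (AlgHom.id R S) x)).re =
        f (quadraticCoordinates e A x).re := by
  simp only [quadraticCoordinates, AlgEquiv.trans_apply, coordinatesBaseChange_map,
    re_baseChangeEquiv_map]

lemma im_quadraticCoordinates_map {A B : Type u} [CommRing A] [Algebra R A] [Algebra F A]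
    [IsScalarTower R F A] [CommRing B] [Algebra R B] [Algebra F B] [IsScalarTower R F B]
    (f : A →ₐ[F] B) (x : A ⊗[R] S) :
    (quadraticCoordinates e B
      (Algebra.TensorProduct.map (f.restrictScalars R) (AlgHom.id R S) x)).im =
        f (quadraticCoordinates e A x).im := by
  simp only [quadraticCoordinates, AlgEquiv.trans_apply, coordinatesBaseChange_map,
    im_baseChangeEquiv_map]

variable {e}

lemma mul_conj_eq_one_iff_norm_quadraticCoordinates
    (he : ∀ s : S, e (1 ⊗ₜ σ s) = star (e (1 ⊗ₜ s))) (A : Type u) [CommRing A]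
    [Algebra R A] [Algebra F A] [IsScalarTower R F A] (x : A ⊗[R] S) :
    x * Algebra.TensorProduct.map (AlgHom.id R A) σ x = 1 ↔
      norm (quadraticCoordinates e A x) = 1 := by
  rw [mul_conj_eq_one_iff_norm_coordinates he, algebraNorm_eq_norm_baseChangeEquiv]
  rfl

variable {H : Type u} [CommRing H] [Algebra R H] {u : H ⊗[R] S}

/-- A homomorphism from `F ⊗ H` is determined by the norm-one element it defines. -/
lemma IsUniversalNormOne.algHom_ext (hu : IsUniversalNormOne σ u) {A : Type u}
    [CommRing A] [Algebra R A] [Algebra F A] [IsScalarTower R F A] {f g : F ⊗[R] H →ₐ[F] A}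
    (h : Algebra.TensorProduct.map ((f.restrictScalars R).comp
          Algebra.TensorProduct.includeRight) (AlgHom.id R S) u =
        Algebra.TensorProduct.map ((g.restrictScalars R).comp
          Algebra.TensorProduct.includeRight) (AlgHom.id R S) u) : f = g := by
  apply Algebra.TensorProduct.ext (by ext)
  refine (hu.existsUnique A (Algebra.TensorProduct.map ((f.restrictScalars R).comp
    Algebra.TensorProduct.includeRight) (AlgHom.id R S) u) ?_).unique rfl h.symm
  rw [map_conj_map_id, ← map_mul, hu.mul_conj, map_one]

/-- Every element of norm one of `A ⊗ S` comes from a homomorphism `F ⊗ H → A`. -/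
lemma IsUniversalNormOne.exists_algHom (hu : IsUniversalNormOne σ u) {A : Type u}
    [CommRing A] [Algebra R A] [Algebra F A] [IsScalarTower R F A] {x : A ⊗[R] S}
    (hx : x * Algebra.TensorProduct.map (AlgHom.id R A) σ x = 1) :
    ∃ f : F ⊗[R] H →ₐ[F] A, Algebra.TensorProduct.map ((f.restrictScalars R).comp
          Algebra.TensorProduct.includeRight) (AlgHom.id R S) u = x := by
  obtain ⟨f, hf, -⟩ := hu.existsUnique A x hx
  refine ⟨Algebra.TensorProduct.lift (Algebra.ofId F A) f fun _ _ => Commute.all _ _, ?_⟩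
  rw [← hf]
  congr 1
  congr 1
  ext h
  simp

/-- In quadratic coordinates, the universal algebra of the norm-one group is a retract of (in fact
isomorphic to) `F[v][y] / (y² + b v y - a v² - 1)`, which is free over `F[v]`. -/
lemma IsUniversalNormOne.flat_of_coordinates (hu : IsUniversalNormOne σ u)
    (he : ∀ s : S, e (1 ⊗ₜ σ s) = star (e (1 ⊗ₜ s))) : Module.Flat F (F ⊗[R] H) := by
  let v : Polynomial F := Polynomial.X
  let K := QuadraticAlgebra (Polynomial F) (1 + a • v ^ 2) (-(b • v))
  have : IsScalarTower F (Polynomial F) K := .of_algebraMap_eq fun _ => rfl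
  have : Module.Flat F K := Module.Flat.trans F (Polynomial F) K
  -- the tautological norm-one element with coordinates `y` and `v`
  let z : QuadraticAlgebra K (algebraMap F K a) (algebraMap F K b) := ⟨omega, algebraMap _ K v⟩
  have hz : norm z = 1 := by
    have h : (omega : K) * omega = _ := omega_mul_omega_eq_add
    simp only [norm_def, z]
    rw [h]
    simp only [Algebra.smul_def, map_add, map_mul, map_one, map_pow, map_neg,
      ← IsScalarTower.algebraMap_apply]
    ring
  obtain ⟨φ, hφ⟩ := hu.exists_algHom (F := F) (A := K) (x := (quadraticCoordinates e K).symm z)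
    ((mul_conj_eq_one_iff_norm_quadraticCoordinates he K _).2 (by simpa using hz))
  let w := Algebra.TensorProduct.map
    (Algebra.TensorProduct.includeRight : H →ₐ[R] F ⊗[R] H) (AlgHom.id R S) u
  have hw : norm (quadraticCoordinates e (F ⊗[R] H) w) = 1 := by
    rw [← mul_conj_eq_one_iff_norm_quadraticCoordinates he, map_conj_map_id, ← map_mul,
      hu.mul_conj, map_one]
  let ψ₀ : Polynomial F →ₐ[F] F ⊗[R] H :=
    Polynomial.aeval (quadraticCoordinates e (F ⊗[R] H) w).im
  let _ : Algebra (Polynomial F) (F ⊗[R] H) := ψ₀.toAlgebra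
  have : IsScalarTower F (Polynomial F) (F ⊗[R] H) := .of_algHom ψ₀
  have hv : algebraMap (Polynomial F) (F ⊗[R] H) v = (quadraticCoordinates e (F ⊗[R] H) w).im :=
    Polynomial.aeval_X _
  let ψ : K →ₐ[Polynomial F] F ⊗[R] H :=
    QuadraticAlgebra.lift ⟨(quadraticCoordinates e (F ⊗[R] H) w).re, by
      rw [norm_def] at hw
      simp only [Algebra.smul_def, map_add, map_mul, map_one, map_pow, map_neg, hv,
        ← IsScalarTower.algebraMap_apply]
      linear_combination hw⟩
  refine Module.Flat.of_retract φ.toLinearMap (ψ.restrictScalars F).toLinearMap ?_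
  suffices h : (ψ.restrictScalars F).comp φ = AlgHom.id F (F ⊗[R] H) from
    LinearMap.ext fun x => DFunLike.congr_fun h x
  apply hu.algHom_ext
  have h1 : (((ψ.restrictScalars F).comp φ).restrictScalars R).comp
      (Algebra.TensorProduct.includeRight : H →ₐ[R] F ⊗[R] H) =
      ((ψ.restrictScalars F).restrictScalars R).comp
        ((φ.restrictScalars R).comp Algebra.TensorProduct.includeRight) := rfl
  have h2 : ((AlgHom.id F (F ⊗[R] H)).restrictScalars R).comp
      (Algebra.TensorProduct.includeRight : H →ₐ[R] F ⊗[R] H) =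
      Algebra.TensorProduct.includeRight := rfl
  rw [h1, h2, Algebra.TensorProduct.map_comp_id_apply, hφ]
  apply (quadraticCoordinates e (F ⊗[R] H)).injective
  refine QuadraticAlgebra.ext ?_ ?_
  · rw [re_quadraticCoordinates_map]
    rw [AlgEquiv.apply_symm_apply]
    exact lift_omega _
  · rw [im_quadraticCoordinates_map]
    simpa [z, ψ, w] using hv

end QuadraticCoordinates

variable {H : Type u} [CommRing H] [Algebra R H] {u : H ⊗[R] S}

lemma IsUniversalNormOne.flat (hu : IsUniversalNormOne σ u)
    (hloc : HasQuadraticCoordinates σ) : Module.Flat R H := by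
  have hl (P : Ideal R) [P.IsMaximal] : IsLocalizedModule.AtPrime P
      (TensorProduct.mk R (Localization.AtPrime P) H 1) :=
    (isLocalizedModule_iff_isBaseChange P.primeCompl (Localization.AtPrime P) _).2
      (TensorProduct.isBaseChange R H _)
  refine Module.flat_of_isLocalized_maximal R H (fun P _ => Localization.AtPrime P ⊗[R] H)
    (fun P _ => TensorProduct.mk R (Localization.AtPrime P) H 1) fun P _ => ?_
  obtain ⟨a, b, e, he⟩ := hloc (Localization.AtPrime P)
  have := hu.flat_of_coordinates he
  exact Module.Flat.trans R (Localization.AtPrime P) _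

/-! ### Smoothness -/

/-- Elements of norm one lift along square-zero extensions in which the trace of some element is
invertible: if `N g' = 1 - d` for a lift `g'`, then `g' (1 + d x / t)` has norm one, `t` being
the trace of `x`. -/
lemma exists_lift_mul_conj_eq_one (hσ : ∀ x, σ (σ x) = x) {x : S} {t : R}
    (hx : x + σ x = algebraMap R S t) {B : Type u} [CommRing B] [Algebra R B] {r : B}
    (ht : algebraMap R B t * r = 1) {I : Ideal B} (hI : I ^ 2 = ⊥) {g : (B ⧸ I) ⊗[R] S}
    (hg : g * Algebra.TensorProduct.map (AlgHom.id R (B ⧸ I)) σ g = 1) :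
    ∃ h : B ⊗[R] S, h * Algebra.TensorProduct.map (AlgHom.id R B) σ h = 1 ∧
      Algebra.TensorProduct.map (Ideal.Quotient.mkₐ R I) (AlgHom.id R S) h = g := by
  let π := Algebra.TensorProduct.map (Ideal.Quotient.mkₐ R I) (AlgHom.id R S)
  let τ := Algebra.TensorProduct.map (AlgHom.id R B) σ
  have hτ (y) : τ (τ y) = y := map_conj_map_conj hσ y
  obtain ⟨g', rfl⟩ : ∃ g', π g' = g := Algebra.TensorProduct.map_surjective _ _
    (Ideal.Quotient.mkₐ_surjective R I) Function.surjective_id g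
  have hsq {d} (hd : π d = 0) : d * d = 0 := by
    have hd' : d ∈ RingHom.ker π := hd
    rw [Algebra.TensorProduct.rTensor_ker _ (Ideal.Quotient.mkₐ_surjective R I),
      show RingHom.ker (Ideal.Quotient.mkₐ R I) = I from Ideal.Quotient.mkₐ_ker R I] at hd'
    have := Ideal.mul_mem_mul hd' hd'
    rw [← Ideal.map_mul, ← sq, hI, Ideal.map_bot] at this
    exact this
  let d := 1 - g' * τ g'
  have hd : π d = 0 := by
    rw [map_sub, map_one, map_mul, ← map_conj_map_id, hg, sub_self]
  have hτd : τ d = d := by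
    simp only [d, map_sub, map_one, map_mul, hτ, mul_comm]
  let y : B ⊗[R] S := r ⊗ₜ x
  have hy : y + τ y = 1 := by
    simp only [y, τ, Algebra.TensorProduct.map_tmul, AlgHom.id_apply, ← TensorProduct.tmul_add, hx]
    rw [Algebra.algebraMap_eq_smul_one t, TensorProduct.tmul_smul, TensorProduct.smul_tmul',
      Algebra.smul_def, ht]
    rfl
  refine ⟨g' * (1 + d * y), ?_, ?_⟩
  · change g' * (1 + d * y) * τ (g' * (1 + d * y)) = 1
    have hN : g' * τ g' = 1 - d := by ring
    rw [map_mul, map_add, map_one, map_mul, hτd]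
    linear_combination (1 + d * y) * (1 + d * τ y) * hN + (1 - d) * d * hy +
      ((1 - d) * y * τ y - 1) * hsq hd
  · change π _ = π _
    rw [map_mul, map_add, map_mul, hd, zero_mul, map_one, add_zero, mul_one]

/-- The norm-one group is formally smooth where a trace is invertible. -/
lemma IsUniversalNormOne.formallySmooth (hu : IsUniversalNormOne σ u) (hσ : ∀ x, σ (σ x) = x)
    {x : S} {t : R} (hx : x + σ x = algebraMap R S t) {F : Type u} [CommRing F] [Algebra R F]
    (ht : IsUnit (algebraMap R F t)) : Algebra.FormallySmooth F (F ⊗[R] H) := by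
  obtain ⟨r, hr⟩ := ht.exists_right_inv
  refine Algebra.FormallySmooth.of_comp_surjective fun B _ _ I hI f => ?_
  let _ : Algebra R B := Algebra.compHom B (algebraMap R F)
  have : IsScalarTower R F B := .of_algebraMap_eq fun _ => rfl
  obtain ⟨h, hh, hh'⟩ := exists_lift_mul_conj_eq_one hσ hx (r := algebraMap F B r)
    (by rw [IsScalarTower.algebraMap_apply R F B, ← map_mul, hr, map_one]) hI
    (g := Algebra.TensorProduct.map ((f.restrictScalars R).comp
      Algebra.TensorProduct.includeRight) (AlgHom.id R S) u)
    (by rw [map_conj_map_id, ← map_mul, hu.mul_conj, map_one])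
  obtain ⟨g, hg⟩ := hu.exists_algHom (F := F) hh
  refine ⟨g, hu.algHom_ext ?_⟩
  rw [← hh', ← hg, ← Algebra.TensorProduct.map_comp_id_apply]
  rfl

/-- In characteristic two, suppose that the norm form of the quadratic algebra is the square of a
linear form. If `X³ = 0`, then `1 + X` has norm one modulo `X²`; a lift of norm one has the square
`1 + X²`, which must be `1`. -/
lemma IsUniversalNormOne.sq_eq_zero_of_formallySmooth (hu : IsUniversalNormOne σ u) {F : Type u}
    [Field F] [CharP F 2] [Algebra R F] {r : F} (e : F ⊗[R] S ≃ₐ[F] QuadraticAlgebra F (r ^ 2) 0)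
    (he : ∀ s : S, e (1 ⊗ₜ σ s) = star (e (1 ⊗ₜ s))) [Algebra.FormallySmooth F (F ⊗[R] H)]
    {A : Type u} [CommRing A] [Algebra F A] {X : A} (hX3 : X ^ 3 = 0) : X ^ 2 = 0 := by
  let _ : Algebra R A := Algebra.compHom A (algebraMap R F)
  have : IsScalarTower R F A := .of_algebraMap_eq fun _ => rfl
  let I : Ideal A := Ideal.span {X ^ 2}
  have hI : I ^ 2 = ⊥ := by
    rw [Ideal.span_singleton_pow, show (X ^ 2) ^ 2 = 0 by linear_combination X * hX3]
    exact Ideal.span_singleton_eq_bot.2 rfl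
  have h2 : (2 : A) = 0 := by
    have : (2 : F) = 0 := CharTwo.two_eq_zero
    rw [← map_ofNat (algebraMap F A) 2, this, map_zero]
  let π : A →ₐ[F] A ⧸ I := Ideal.Quotient.mkₐ F I
  let z : QuadraticAlgebra (A ⧸ I) (algebraMap F (A ⧸ I) (r ^ 2)) (algebraMap F (A ⧸ I) 0) :=
    ⟨1 + π X, 0⟩
  have hz : norm z = 1 := by
    have hπ : π (X ^ 2) = 0 := Ideal.Quotient.eq_zero_iff_mem.2 (Ideal.mem_span_singleton_self _)
    have h2' : π 2 = 0 := by rw [h2, map_zero]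
    rw [map_pow] at hπ
    rw [map_ofNat] at h2'
    simp only [norm_def, z]
    linear_combination hπ + π X * h2'
  obtain ⟨f, hf⟩ := hu.exists_algHom (F := F)
    ((mul_conj_eq_one_iff_norm_quadraticCoordinates he (A ⧸ I)
      ((quadraticCoordinates e (A ⧸ I)).symm z)).2 (by simpa using hz))
  obtain ⟨g, hg⟩ := Algebra.FormallySmooth.comp_surjective F (F ⊗[R] H) I hI f
  let y := quadraticCoordinates e A (Algebra.TensorProduct.map ((g.restrictScalars R).comp
    Algebra.TensorProduct.includeRight) (AlgHom.id R S) u)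
  have hy : norm y = 1 := by
    rw [← mul_conj_eq_one_iff_norm_quadraticCoordinates he, map_conj_map_id, ← map_mul,
      hu.mul_conj, map_one]
  have hπ : Algebra.TensorProduct.map (π.restrictScalars R) (AlgHom.id R S)
      (Algebra.TensorProduct.map ((g.restrictScalars R).comp
        Algebra.TensorProduct.includeRight) (AlgHom.id R S) u) =
        (quadraticCoordinates e (A ⧸ I)).symm z := by
    rw [← hf, ← hg, ← Algebra.TensorProduct.map_comp_id_apply]
    rfl
  have hre : π y.re = 1 + π X := by
    rw [← re_quadraticCoordinates_map, hπ, AlgEquiv.apply_symm_apply]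
  have him : π y.im = 0 := by
    rw [← im_quadraticCoordinates_map, hπ, AlgEquiv.apply_symm_apply]
  obtain ⟨c, hc⟩ : X ^ 2 ∣ y.re - (1 + X) := Ideal.mem_span_singleton.1
    (Ideal.Quotient.eq_zero_iff_mem.1 (by
      change π _ = 0
      rw [map_sub, hre, map_add, map_one, sub_self]))
  obtain ⟨c', hc'⟩ : X ^ 2 ∣ y.im := Ideal.mem_span_singleton.1
    (Ideal.Quotient.eq_zero_iff_mem.1 him)
  rw [norm_def, hc', sub_eq_iff_eq_add.1 hc, map_zero] at hy
  set ρ := algebraMap F A (r ^ 2)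
  linear_combination hy - X * h2 -
    (X * c ^ 2 + 2 * c - X * c' ^ 2 * ρ) * hX3 - c * X ^ 2 * h2

/-- In characteristic two, a norm form which is the square of a linear form defines a non-smooth
group: `X³ = 0` does not imply `X² = 0`. -/
lemma IsUniversalNormOne.not_formallySmooth (hu : IsUniversalNormOne σ u) {F : Type u} [Field F]
    [CharP F 2] [Algebra R F] {r : F} (e : F ⊗[R] S ≃ₐ[F] QuadraticAlgebra F (r ^ 2) 0)
    (he : ∀ s : S, e (1 ⊗ₜ σ s) = star (e (1 ⊗ₜ s))) :
    ¬ Algebra.FormallySmooth F (F ⊗[R] H) := by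
  intro hsm
  have h := hu.sq_eq_zero_of_formallySmooth e he
    (A := Polynomial F ⧸ Ideal.span {(Polynomial.X : Polynomial F) ^ 3})
    (X := Ideal.Quotient.mk _ Polynomial.X)
    (by
      rw [← map_pow]
      exact Ideal.Quotient.eq_zero_iff_mem.2 (Ideal.mem_span_singleton_self _))
  rw [← map_pow, Ideal.Quotient.eq_zero_iff_mem, Ideal.mem_span_singleton,
    pow_dvd_pow_iff Polynomial.X_ne_zero Polynomial.not_isUnit_X] at h
  norm_num at h

end Fibres

/-! ### Splitting of primes and roots of the quadratic polynomial -/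

namespace QuadraticAlgebra

variable {F S : Type*} [Field F] {a b : F} [CommRing S] {ρ : S →+* QuadraticAlgebra F a b}

lemma exists_roots_or_forall_ne (a b : F) :
    (∃ r s, b = r + s ∧ a = -(r * s)) ∨ ∀ r, r ^ 2 ≠ a + b * r := by
  by_cases! h : ∃ r, r ^ 2 = a + b * r
  · obtain ⟨r, hr⟩ := h
    exact .inl ⟨r, b - r, by ring, by linear_combination -hr⟩
  · exact .inr h

lemma isPrime_ker_of_forall_ne (h : ∀ r, r ^ 2 ≠ a + b * r) : (RingHom.ker ρ).IsPrime := by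
  have : Fact (∀ r, r ^ 2 ≠ a + b * r) := ⟨h⟩
  exact RingHom.ker_isPrime ρ

lemma omega_sub_ne_zero (r : F) : (omega - algebraMap F (QuadraticAlgebra F a b) r) ≠ 0 := by
  intro h
  simpa using congrArg im h

lemma omega_sub_mul_omega_sub {r s : F} (hb : b = r + s) (ha : a = -(r * s)) :
    (omega - algebraMap F (QuadraticAlgebra F a b) r) * (omega - algebraMap F _ s) = 0 := by
  subst ha hb
  ext
  · simp
  · simp
    ring

lemma not_isPrime_ker_of_roots (hρ : Function.Surjective ρ) {r s : F} (hb : b = r + s)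
    (ha : a = -(r * s)) : ¬ (RingHom.ker ρ).IsPrime := by
  intro h
  obtain ⟨x, hx⟩ := hρ (omega - algebraMap F _ r)
  obtain ⟨y, hy⟩ := hρ (omega - algebraMap F _ s)
  have hxy : x * y ∈ RingHom.ker ρ := by
    rw [RingHom.mem_ker, map_mul, hx, hy, omega_sub_mul_omega_sub hb ha]
  rcases h.mem_or_mem hxy with h | h
  · exact omega_sub_ne_zero r (hx.symm.trans h)
  · exact omega_sub_ne_zero s (hy.symm.trans h)

lemma eq_zero_of_sq_eq_zero {r s : F} (hb : b = r + s) (ha : a = -(r * s)) (hrs : r ≠ s)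
    {z : QuadraticAlgebra F a b} (hz : z ^ 2 = 0) : z = 0 := by
  have h1 : z.re + z.im * r = 0 := by
    rw [← evalRoot_apply hb ha]
    exact pow_eq_zero_iff two_ne_zero |>.1 (by rw [← map_pow, hz, map_zero])
  have h2 : z.re + z.im * s = 0 := by
    rw [← evalRoot_apply (hb.trans (add_comm r s)) (ha.trans (by ring))]
    exact pow_eq_zero_iff two_ne_zero |>.1 (by rw [← map_pow, hz, map_zero])
  have him : z.im = 0 := by
    have : z.im * (r - s) = 0 := by linear_combination h1 - h2
    exact (mul_eq_zero.1 this).resolve_right (sub_ne_zero.2 hrs)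
  rw [him, zero_mul, add_zero] at h1
  exact QuadraticAlgebra.ext h1 him

variable [IsDedekindDomain S]

/-- If the kernel of `ρ` is a product of two distinct primes, the polynomial `X² - bX - a` has
two distinct roots. -/
lemma exists_roots_of_ker_eq_mul (hρ : Function.Surjective ρ) (hbot : RingHom.ker ρ ≠ ⊥)
    {q₁ q₂ : Ideal S} (h₁ : q₁.IsPrime) (h₂ : q₂.IsPrime) (hne : q₁ ≠ q₂)
    (h : RingHom.ker ρ = q₁ * q₂) : ∃ r s, b = r + s ∧ a = -(r * s) ∧ IsUnit (r - s) := by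
  have hb₁ : q₁ ≠ ⊥ := by rintro rfl; simp [h] at hbot
  have hb₂ : q₂ ≠ ⊥ := by rintro rfl; simp [h] at hbot
  rcases exists_roots_or_forall_ne a b with ⟨r, s, hb, ha⟩ | hirr
  · refine ⟨r, s, hb, ha, (sub_ne_zero.2 ?_).isUnit⟩
    rintro rfl
    obtain ⟨x, hx⟩ := hρ (omega - algebraMap F _ r)
    have hxx : x * x ∈ q₁ * q₂ := by
      rw [← h, RingHom.mem_ker, map_mul, hx, omega_sub_mul_omega_sub hb ha]
    have hx₁ : x ∈ q₁ := (or_self_iff (a := x ∈ q₁)).1 (h₁.mem_or_mem (Ideal.mul_le_left hxx))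
    have hx₂ : x ∈ q₂ := (or_self_iff (a := x ∈ q₂)).1 (h₂.mem_or_mem (Ideal.mul_le_right hxx))
    have hcop : IsCoprime q₁ q₂ := Ideal.isCoprime_iff_sup_eq.2
      ((h₁.isMaximal hb₁).coprime_of_ne (h₂.isMaximal hb₂) hne)
    have hx' : x ∈ RingHom.ker ρ := by
      rw [h, Ideal.mul_eq_inf_of_isCoprime hcop]
      exact ⟨hx₁, hx₂⟩
    exact omega_sub_ne_zero r (hx.symm.trans hx')
  · have hp := isPrime_ker_of_forall_ne (ρ := ρ) hirr
    have hle : q₁ * q₂ ≤ RingHom.ker ρ := h.ge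
    rcases hp.mul_le.1 hle with hle | hle
    · have heq : q₁ = RingHom.ker ρ := le_antisymm hle (h.le.trans Ideal.mul_le_left)
      have := mul_left_cancel₀ hb₁ ((heq.trans h).symm.trans (mul_one q₁).symm)
      exact absurd (this.trans Ideal.one_eq_top) h₂.ne_top
    · have heq : q₂ = RingHom.ker ρ := le_antisymm hle (h.le.trans Ideal.mul_le_right)
      have := mul_right_cancel₀ hb₂ ((heq.trans h).symm.trans (one_mul q₂).symm)
      exact absurd (this.trans Ideal.one_eq_top) h₁.ne_top

/-- If the kernel of `ρ` is the square of a prime, the polynomial `X² - bX - a` has a double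
root. -/
lemma exists_double_root_of_ker_eq_sq (hbot : RingHom.ker ρ ≠ ⊥)
    {q : Ideal S} (hq : q.IsPrime) (h : RingHom.ker ρ = q ^ 2) :
    ∃ r, b = r + r ∧ a = -(r * r) := by
  have hb : q ≠ ⊥ := by rintro rfl; simp [h] at hbot
  have hlt : RingHom.ker ρ < q := by
    rw [h, sq]
    refine lt_of_le_of_ne Ideal.mul_le_right fun heq => hq.ne_top ?_
    exact mul_left_cancel₀ hb (heq.trans (Ideal.mul_top q).symm)
  obtain ⟨x, hxq, hx⟩ := SetLike.exists_of_lt hlt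
  have hx2 : x ^ 2 ∈ RingHom.ker ρ := h ▸ Ideal.pow_mem_pow hxq 2
  have hx0 : ρ x ^ 2 = 0 := by rw [← map_pow]; exact hx2
  rcases exists_roots_or_forall_ne a b with ⟨r, s, hb, ha⟩ | hirr
  · obtain rfl | hrs := eq_or_ne r s
    · exact ⟨r, hb, ha⟩
    · exact absurd (eq_zero_of_sq_eq_zero hb ha hrs hx0) hx
  · exact absurd ((isPrime_ker_of_forall_ne (ρ := ρ) hirr).mem_of_pow_mem 2 hx2) hx

/-- If the polynomial `X² - bX - a` has a double root, the kernel of `ρ` is the square of a prime,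
namely of the kernel of the evaluation at the root. -/
lemma exists_ker_eq_sq_of_double_root (hρ : Function.Surjective ρ)
    {r : F} (hb : b = r + r) (ha : a = -(r * r)) :
    ∃ q : Ideal S, q.IsPrime ∧ RingHom.ker ρ = q ^ 2 := by
  have hmul (z w : QuadraticAlgebra F a b) (hz : evalRoot hb ha z = 0)
      (hw : evalRoot hb ha w = 0) : z * w = 0 := by
    have key (z : QuadraticAlgebra F a b) (hz : evalRoot hb ha z = 0) :
        z = algebraMap F _ z.im * (omega - algebraMap F _ r) := by
      rw [evalRoot_apply] at hz
      ext
      · simp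
        linear_combination hz
      · simp
    rw [key z hz, key w hw]
    linear_combination (algebraMap F (QuadraticAlgebra F a b) z.im) * (algebraMap F _ w.im) *
      omega_sub_mul_omega_sub hb ha
  let ev : S →+* F := (evalRoot hb ha : QuadraticAlgebra F a b →+* F).comp ρ
  have hprime : (RingHom.ker ev).IsPrime := RingHom.ker_isPrime ev
  have hle : RingHom.ker ρ ≤ RingHom.ker ev := fun x hx => by
    rw [RingHom.mem_ker] at hx ⊢
    simp [ev, hx]
  have hlt : RingHom.ker ρ ≠ RingHom.ker ev := fun h =>
    not_isPrime_ker_of_roots hρ hb ha (h ▸ hprime)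
  have hsq : RingHom.ker ev ^ 2 ≤ RingHom.ker ρ := by
    rw [sq, Ideal.mul_le]
    intro x hx y hy
    rw [RingHom.mem_ker, map_mul]
    exact hmul _ _ hx hy
  refine ⟨RingHom.ker ev, hprime, ?_⟩
  by_cases hb0 : RingHom.ker ev = ⊥
  · exact absurd (by rw [hb0] at hle ⊢; exact le_bot_iff.1 hle) hlt
  obtain ⟨i, hi, hki⟩ := (dvd_prime_pow (Ideal.prime_of_isPrime hb0 hprime) 2).1
    (Ideal.dvd_iff_le.2 hsq)
  rw [associated_iff_eq] at hki
  interval_cases i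
  · rw [pow_zero, Ideal.one_eq_top] at hki
    exact absurd (top_le_iff.1 (hki ▸ hle)) hprime.ne_top
  · exact absurd (hki.trans (pow_one _)) hlt
  · exact hki

end QuadraticAlgebra

section Reduction

open QuadraticAlgebra

variable {R S : Type*} [CommRing R] [CommRing S] [Algebra R S] (p : Ideal R) {a b : R ⧸ p}
  (e : (R ⧸ p) ⊗[R] S ≃ₐ[R ⧸ p] QuadraticAlgebra (R ⧸ p) a b)

/-- Reduction modulo `p`, in quadratic coordinates. -/
noncomputable def reductionInCoordinates : S →+* QuadraticAlgebra (R ⧸ p) a b :=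
  (e : (R ⧸ p) ⊗[R] S →+* QuadraticAlgebra (R ⧸ p) a b).comp
    (Algebra.TensorProduct.includeRight : S →ₐ[R] (R ⧸ p) ⊗[R] S)

lemma reductionInCoordinates_apply (s : S) : reductionInCoordinates p e s = e (1 ⊗ₜ s) := rfl

lemma reductionInCoordinates_surjective : Function.Surjective (reductionInCoordinates p e) :=
  e.surjective.comp (TensorProduct.mk_surjective R S (R ⧸ p) Ideal.Quotient.mk_surjective)

lemma ker_reductionInCoordinates :
    RingHom.ker (reductionInCoordinates p e) = p.map (algebraMap R S) := by
  ext s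
  rw [RingHom.mem_ker, reductionInCoordinates_apply, EmbeddingLike.map_eq_zero_iff,
    ← Ideal.Quotient.eq_zero_iff_mem,
    ← map_eq_zero_iff _ (Algebra.TensorProduct.quotIdealMapEquivTensorQuot S p).injective,
    Algebra.TensorProduct.quotIdealMapEquivTensorQuot_mk,
    ← (TensorProduct.comm R S (R ⧸ p)).map_eq_zero_iff, TensorProduct.comm_tmul]

lemma ker_reductionInCoordinates_ne_bot [FaithfulSMul R S] (hp : p ≠ ⊥) :
    RingHom.ker (reductionInCoordinates p e) ≠ ⊥ := by
  rwa [ker_reductionInCoordinates, Ne,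
    Ideal.map_eq_bot_iff_of_injective (FaithfulSMul.algebraMap_injective R S)]

/-- If `p` contains all traces, then the residue characteristic is `2` and `p` is ramified: modulo
`p`, the quadratic polynomial becomes `X² - a`, with `a` a square. -/
lemma charTwo_and_ker_eq_sq_of_trace_mem [IsDedekindDomain S] [Finite (R ⧸ p)] [p.IsMaximal]
    {σ : S →ₐ[R] S}
    (he : ∀ s : S, e (1 ⊗ₜ σ s) = star (e (1 ⊗ₜ s)))
    (htr : ∀ x, ∃ t, x + σ x = algebraMap R S t)
    (hp : ∀ x t, x + σ x = algebraMap R S t → t ∈ p) :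
    CharP (R ⧸ p) 2 ∧ ∃ q : Ideal S, q.IsPrime ∧ p.map (algebraMap R S) = q ^ 2 := by
  let _ : Field (R ⧸ p) := Ideal.Quotient.field p
  have h2 : (2 : R ⧸ p) = 0 := by
    rw [← map_ofNat (Ideal.Quotient.mk p) 2]
    exact Ideal.Quotient.eq_zero_iff_mem.2 (hp 1 2 (by rw [map_one, map_ofNat]; norm_num))
  have hchar : CharP (R ⧸ p) 2 := CharTwo.of_one_ne_zero_of_two_eq_zero one_ne_zero h2
  refine ⟨hchar, ?_⟩
  have hb : b = 0 := by
    obtain ⟨w, hw⟩ := reductionInCoordinates_surjective p e omega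
    rw [reductionInCoordinates_apply] at hw
    obtain ⟨t, ht⟩ := htr w
    have h := reductionInCoordinates_apply p e (w + σ w)
    rw [TensorProduct.tmul_add, map_add e, he, hw, ht, RingHom.mem_ker.1
      (ker_reductionInCoordinates p e ▸ Ideal.mem_map_of_mem _ (hp w t ht))] at h
    simpa using (congrArg re h).symm
  obtain ⟨r, hr⟩ := FiniteField.isSquare_of_char_two (ringChar.eq (R ⧸ p) 2) a
  rw [← ker_reductionInCoordinates p e]
  exact exists_ker_eq_sq_of_double_root (reductionInCoordinates_surjective p e) (r := r)
    (by linear_combination hb - r * h2) (by linear_combination hr + r * r * h2)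

end Reduction

/-! ### Smoothness over open subschemes of the base -/

section SmoothLocus

/-- If the pullback of `f` along `j` has a property stable under base change, then so does its
pullback along every morphism factoring through `j`. -/
lemma CategoryTheory.MorphismProperty.of_isPullback_of_factors {C : Type*} [Category C]
    {P : MorphismProperty C} [P.IsStableUnderBaseChange] {X Y Z W Z' W' : C} {f : X ⟶ Y}
    {a : Z' ⟶ X} {b : Z' ⟶ Z} {j : Z ⟶ Y} (sq : IsPullback a b f j) (hb : P b)
    {a' : W' ⟶ X} {b' : W' ⟶ W} {k : W ⟶ Z} {l : W ⟶ Y} (sq' : IsPullback a' b' f l)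
    (hl : k ≫ j = l) : P b' := by
  subst hl
  have h : sq.lift a' (b' ≫ k) (by simp [sq'.w]) ≫ a = a' := sq.lift_fst _ _ _
  exact P.of_isPullback (IsPullback.of_right (h.symm ▸ sq') (by simp) sq) hb

variable {R H : Type u} [CommRing R] [CommRing H] [Algebra R H]

lemma isPullback_specMap_tensorProduct (F : Type u) [CommRing F] [Algebra R F] :
    IsPullback
      (Spec.map (CommRingCat.ofHom
        (Algebra.TensorProduct.includeRight : H →ₐ[R] F ⊗[R] H).toRingHom))
      (Spec.map (CommRingCat.ofHom (algebraMap F (F ⊗[R] H))))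
      (Spec.map (CommRingCat.ofHom (algebraMap R H)))
      (Spec.map (CommRingCat.ofHom (algebraMap R F))) :=
  (isPullback_SpecMap_of_isPushout _ _ _ _ (CommRingCat.isPushout_tensorProduct R F H)).flip

lemma smooth_specMap_algebraMap_iff {F A : Type u} [CommRing F] [CommRing A] [Algebra F A] :
    Smooth (Spec.map (CommRingCat.ofHom (algebraMap F A))) ↔ Algebra.Smooth F A := by
  rw [HasRingHomProperty.Spec_iff (P := @Smooth)]
  exact RingHom.smooth_algebraMap

/-- `Spec H → Spec R` is smooth over an open set `U` if it becomes smooth over a principal open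
neighbourhood of every point of `U`. -/
lemma smooth_morphismRestrict_of_forall_exists (U : (Spec (.of R)).Opens)
    (h : ∀ x ∈ U, ∃ t : R, t ∉ x.asIdeal ∧
      Algebra.Smooth (Localization.Away t) (Localization.Away t ⊗[R] H)) :
    Smooth (Spec.map (CommRingCat.ofHom (algebraMap R H)) ∣_ U) := by
  have : IsZariskiLocalAtTarget @Smooth.{u} :=
    HasRingHomProperty.instIsZariskiLocalAtTarget _
  apply IsZariskiLocalAtTarget.of_forall_exists_morphismRestrict (P := @Smooth.{u})
  rintro ⟨x, hx⟩
  -- the open subset `U ∩ D(t)` of `U` factors through `Spec R_t`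
  obtain ⟨t, ht, hsm⟩ := h x hx
  let D : (Spec (.of R)).Opens := PrimeSpectrum.basicOpen t
  let j := Spec.map (CommRingCat.ofHom (algebraMap R (Localization.Away t)))
  have hj : IsOpenImmersion j := IsOpenImmersion.of_isLocalization t
  have hrange : Set.range (((U.ι ⁻¹ᵁ D).ι ≫ U.ι)) ⊆ Set.range j := by
    rw [show Set.range j = (D : Set (Spec (.of R))) from
      PrimeSpectrum.localization_away_comap_range (Localization.Away t) t]
    rintro _ ⟨y, rfl⟩
    exact y.2
  refine ⟨U.ι ⁻¹ᵁ D, ht, ?_⟩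
  exact MorphismProperty.of_isPullback_of_factors
    (isPullback_specMap_tensorProduct (Localization.Away t))
    (smooth_specMap_algebraMap_iff.2 hsm)
    ((isPullback_morphismRestrict _ (U.ι ⁻¹ᵁ D)).flip.paste_horiz
      (isPullback_morphismRestrict _ U).flip)
    (IsOpenImmersion.lift_fac j _ hrange)

/-- If `Spec H → Spec R` is smooth over an open set containing the prime `p`, then its fibre at `p`
is smooth. -/
lemma smooth_of_smooth_morphismRestrict (U : (Spec (.of R)).Opens)
    (h : Smooth (Spec.map (CommRingCat.ofHom (algebraMap R H)) ∣_ U)) (x : PrimeSpectrum R)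
    (hx : x ∈ U) [x.asIdeal.IsMaximal] :
    Algebra.Smooth (R ⧸ x.asIdeal) ((R ⧸ x.asIdeal) ⊗[R] H) := by
  let j := Spec.map (CommRingCat.ofHom (algebraMap R (R ⧸ x.asIdeal)))
  have hrange : Set.range j ⊆ Set.range U.ι := by
    rw [Scheme.Opens.range_ι]
    rintro _ ⟨y, rfl⟩
    have hy : j y = x := by
      refine PrimeSpectrum.ext (Ideal.IsMaximal.eq_of_le inferInstance (j y).isPrime.ne_top ?_).symm
      intro t ht
      change algebraMap R (R ⧸ x.asIdeal) t ∈ y.asIdeal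
      rw [Ideal.Quotient.algebraMap_eq, Ideal.Quotient.eq_zero_iff_mem.2 ht]
      exact y.asIdeal.zero_mem
    rw [hy]
    exact hx
  rw [← smooth_specMap_algebraMap_iff]
  exact MorphismProperty.of_isPullback_of_factors (P := @Smooth)
    (isPullback_morphismRestrict _ U).flip h (isPullback_specMap_tensorProduct _)
    (IsOpenImmersion.lift_fac U.ι j hrange)

end SmoothLocus

/-! ### The fibres of the norm-one group -/

section Integral

open QuadraticAlgebra

variable {k L : Type u} [Field k] [Field L] [NumberField k] [NumberField L] [Algebra k L]
  {σ : 𝓞 L →ₐ[𝓞 k] 𝓞 L}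

variable (k L) in
/-- `L` is the generic fibre of `𝓞 L` over `𝓞 k`. -/
lemma nonempty_algEquiv_tensorProduct_ringOfIntegers : Nonempty (k ⊗[𝓞 k] 𝓞 L ≃ₐ[k] L) := by
  have hloc : IsLocalization (Algebra.algebraMapSubmonoid (𝓞 L) (nonZeroDivisors (𝓞 k))) L :=
    IsIntegralClosure.isLocalization (𝓞 k) k L (𝓞 L)
  have hbc := (isLocalizedModule_iff_isBaseChange (nonZeroDivisors (𝓞 k)) k
    (IsScalarTower.toAlgHom (𝓞 k) (𝓞 L) L).toLinearMap).1
    (isLocalizedModule_iff_isLocalization.2 hloc)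
  let f : k ⊗[𝓞 k] 𝓞 L →ₐ[k] L := Algebra.TensorProduct.lift (Algebra.ofId k L)
    (IsScalarTower.toAlgHom (𝓞 k) (𝓞 L) L) fun _ _ => Commute.all _ _
  have hf : ⇑f = hbc.equiv := by
    ext x
    induction x with
    | zero => simp
    | tmul c s => simp [f, IsBaseChange.equiv_tmul, Algebra.ofId_apply, Algebra.smul_def]
    | add x y hx hy => rw [map_add, map_add, hx, hy]
  exact ⟨AlgEquiv.ofBijective f (hf ▸ hbc.equiv.bijective)⟩

variable {T : GroupSchemeOver (𝓞 k)}

lemma represents_genericFibre (hT : T.Represents (integralNormOneGroup k L))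
    (hσ : InducesGaloisNorm σ)
    (hloc : HasQuadraticCoordinates σ) :
    (T.baseChange k).Represents (normOneTorus k L) := by
  obtain ⟨a, b, e, he⟩ := hloc k
  obtain ⟨f⟩ := nonempty_algEquiv_tensorProduct_ringOfIntegers k L
  exact hT.baseChange k (restrictScalarsIsoNormOneTorus hσ e he ≪≫
    normOneTorusCongr (e.symm.trans f))

section Fibre

variable {p : Ideal (𝓞 k)} [p.IsPrime]

lemma represents_fibre_of_splits (hT : T.Represents (integralNormOneGroup k L))
    (hσ : InducesGaloisNorm σ)
    (hp : p ≠ ⊥) {a b : 𝓞 k ⧸ p}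
    (e : (𝓞 k ⧸ p) ⊗[𝓞 k] 𝓞 L ≃ₐ[𝓞 k ⧸ p] QuadraticAlgebra (𝓞 k ⧸ p) a b)
    (he : ∀ s, e (1 ⊗ₜ σ s) = star (e (1 ⊗ₜ s))) (h : SplitsInQuadratic k L p) :
    (T.baseChange (𝓞 k ⧸ p)).Represents (multiplicativeGroup (𝓞 k ⧸ p)) := by
  have : p.IsMaximal := Ideal.IsPrime.isMaximal inferInstance hp
  let _ : Field (𝓞 k ⧸ p) := Ideal.Quotient.field p
  obtain ⟨q₁, q₂, h₁, h₂, hne, h⟩ := h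
  obtain ⟨r, s, hb, ha, hrs⟩ := exists_roots_of_ker_eq_mul
    (reductionInCoordinates_surjective p e) (ker_reductionInCoordinates_ne_bot p e hp) h₁ h₂ hne
    ((ker_reductionInCoordinates p e).trans h)
  exact hT.baseChange _ (restrictScalarsIsoNormOneTorus hσ e he ≪≫
    normOneTorusIsoMultiplicativeGroup hb ha hrs)

lemma represents_fibre_of_isRamified (hT : T.Represents (integralNormOneGroup k L))
    (hσ : InducesGaloisNorm σ)
    (hp : p ≠ ⊥) {a b : 𝓞 k ⧸ p}
    (e : (𝓞 k ⧸ p) ⊗[𝓞 k] 𝓞 L ≃ₐ[𝓞 k ⧸ p] QuadraticAlgebra (𝓞 k ⧸ p) a b)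
    (he : ∀ s, e (1 ⊗ₜ σ s) = star (e (1 ⊗ₜ s))) (h : IsRamifiedInQuadratic k L p) :
    (T.baseChange (𝓞 k ⧸ p)).Represents (additiveTimesMuTwo (𝓞 k ⧸ p)) := by
  have : p.IsMaximal := Ideal.IsPrime.isMaximal inferInstance hp
  let _ : Field (𝓞 k ⧸ p) := Ideal.Quotient.field p
  obtain ⟨q, hq, h⟩ := h
  obtain ⟨r, hb, ha⟩ := exists_double_root_of_ker_eq_sq
    (ker_reductionInCoordinates_ne_bot p e hp) hq ((ker_reductionInCoordinates p e).trans h)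
  exact hT.baseChange _ (restrictScalarsIsoNormOneTorus hσ e he ≪≫
    normOneTorusIsoAdditiveTimesMuTwo hb ha)

/-- Over a finite field, a quadratic algebra without roots is isomorphic to every quadratic
extension. -/
lemma QuadraticAlgebra.nonempty_algEquiv_of_forall_ne {F : Type u} [Field F] [Finite F] {a b : F}
    (h : ∀ r, r ^ 2 ≠ a + b * r) (l : Type u) [Field l] [Algebra F l]
    [Algebra.IsQuadraticExtension F l] : Nonempty (QuadraticAlgebra F a b ≃ₐ[F] l) := by
  have : Fact (∀ r, r ^ 2 ≠ a + b * r) := ⟨h⟩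
  have : Finite l := Module.finite_of_finite F
  have hrank : Module.finrank F (QuadraticAlgebra F a b) = Module.finrank F l := by
    rw [Algebra.IsQuadraticExtension.finrank_eq_two F l,
      Module.finrank_eq_card_basis (QuadraticAlgebra.basis a b), Fintype.card_fin]
  obtain ⟨f⟩ := FiniteField.nonempty_algHom_of_finrank_dvd (dvd_of_eq hrank)
  exact ⟨AlgEquiv.ofBijective f ⟨f.toRingHom.injective,
    (LinearMap.injective_iff_surjective_of_finrank_eq_finrank (f := f.toLinearMap) hrank).1
      f.toRingHom.injective⟩⟩

lemma represents_fibre_of_isInert (hT : T.Represents (integralNormOneGroup k L))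
    (hσ : InducesGaloisNorm σ)
    (hp : p ≠ ⊥) {a b : 𝓞 k ⧸ p}
    (e : (𝓞 k ⧸ p) ⊗[𝓞 k] 𝓞 L ≃ₐ[𝓞 k ⧸ p] QuadraticAlgebra (𝓞 k ⧸ p) a b)
    (he : ∀ s, e (1 ⊗ₜ σ s) = star (e (1 ⊗ₜ s))) (h : IsInertInQuadratic k L p)
    (l : Type u) [Field l] [Algebra (𝓞 k ⧸ p) l] [Algebra.IsQuadraticExtension (𝓞 k ⧸ p) l] :
    (T.baseChange (𝓞 k ⧸ p)).Represents (normOneTorus (𝓞 k ⧸ p) l) := by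
  have : p.IsMaximal := Ideal.IsPrime.isMaximal inferInstance hp
  have : Finite (𝓞 k ⧸ p) := Ideal.finiteQuotientOfFreeOfNeBot p hp
  let _ : Field (𝓞 k ⧸ p) := Ideal.Quotient.field p
  have hirr : ∀ r, r ^ 2 ≠ a + b * r := by
    refine (exists_roots_or_forall_ne a b).resolve_left ?_
    rintro ⟨r, s, hb, ha⟩
    refine not_isPrime_ker_of_roots (reductionInCoordinates_surjective p e) hb ha ?_
    rw [ker_reductionInCoordinates]
    exact h
  obtain ⟨f⟩ := QuadraticAlgebra.nonempty_algEquiv_of_forall_ne hirr l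
  exact hT.baseChange _ (restrictScalarsIsoNormOneTorus hσ e he ≪≫ normOneTorusCongr f)

end Fibre

/-! ### The smooth locus -/

section SmoothLocus

variable {H : Type u} [CommRing H] [Algebra (𝓞 k) H] {u : H ⊗[𝓞 k] 𝓞 L}

/-- The fibre of the norm-one group at a ramified prime of residue characteristic two is not
smooth. -/
lemma IsUniversalNormOne.not_smooth_fibre (hu : IsUniversalNormOne σ u) {p : Ideal (𝓞 k)}
    [p.IsPrime] (hp : p ≠ ⊥) {a b : 𝓞 k ⧸ p}
    (e : (𝓞 k ⧸ p) ⊗[𝓞 k] 𝓞 L ≃ₐ[𝓞 k ⧸ p] QuadraticAlgebra (𝓞 k ⧸ p) a b)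
    (he : ∀ s, e (1 ⊗ₜ σ s) = star (e (1 ⊗ₜ s))) [CharP (𝓞 k ⧸ p) 2]
    (h : IsRamifiedInQuadratic k L p) :
    ¬ Algebra.Smooth (𝓞 k ⧸ p) ((𝓞 k ⧸ p) ⊗[𝓞 k] H) := by
  have : p.IsMaximal := Ideal.IsPrime.isMaximal inferInstance hp
  let _ : Field (𝓞 k ⧸ p) := Ideal.Quotient.field p
  obtain ⟨q, hq, h⟩ := h
  obtain ⟨r, hb, ha⟩ := exists_double_root_of_ker_eq_sq
    (ker_reductionInCoordinates_ne_bot p e hp) hq ((ker_reductionInCoordinates p e).trans h)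
  rw [CharTwo.add_self_eq_zero] at hb
  rw [CharTwo.neg_eq, ← sq] at ha
  subst hb ha
  exact fun hsm => hu.not_formallySmooth e he hsm.formallySmooth

/-- At every point of the tame locus, some trace is invertible. -/
lemma exists_trace_notMem (hloc : HasQuadraticCoordinates σ)
    (htr : ∀ x, ∃ t, x + σ x = algebraMap (𝓞 k) (𝓞 L) t) (x : PrimeSpectrum (𝓞 k))
    (hx : x ∈ tameLocus k L) :
    ∃ y t, y + σ y = algebraMap (𝓞 k) (𝓞 L) t ∧ t ∉ x.asIdeal := by
  by_contra! h
  have h2 : (2 : 𝓞 k) ∈ x.asIdeal := h 1 2 (by rw [map_one, map_ofNat]; norm_num)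
  have hp : x.asIdeal ≠ ⊥ := fun hbot =>
    two_ne_zero (α := 𝓞 k) (by rwa [hbot, Ideal.mem_bot] at h2)
  have : x.asIdeal.IsMaximal := x.isPrime.isMaximal hp
  have : Finite (𝓞 k ⧸ x.asIdeal) := Ideal.finiteQuotientOfFreeOfNeBot _ hp
  let _ : Field (𝓞 k ⧸ x.asIdeal) := Ideal.Quotient.field _
  obtain ⟨a, b, e, he⟩ := hloc (𝓞 k ⧸ x.asIdeal)
  exact hx ⟨hp, charTwo_and_ker_eq_sq_of_trace_mem x.asIdeal e he htr h⟩

/-- The tame locus is the largest open set over which the norm-one group is smooth. -/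
lemma IsUniversalNormOne.isGreatest_smooth (hu : IsUniversalNormOne σ u)
    (hfp : Algebra.FinitePresentation (𝓞 k) H) (hσσ : ∀ x, σ (σ x) = x)
    (hloc : HasQuadraticCoordinates σ)
    (htr : ∀ x, ∃ t, x + σ x = algebraMap (𝓞 k) (𝓞 L) t) :
    IsGreatest {V : (Spec (CommRingCat.of (𝓞 k))).Opens |
      Smooth (Spec.map (CommRingCat.ofHom (algebraMap (𝓞 k) H)) ∣_ V)} (tameLocus k L) := by
  refine ⟨smooth_morphismRestrict_of_forall_exists _ fun x hx => ?_, fun V hV x hx => ?_⟩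
  · obtain ⟨y, t, hy, ht⟩ := exists_trace_notMem hloc htr x hx
    exact ⟨t, ht, hu.formallySmooth hσσ hy (IsLocalization.Away.algebraMap_isUnit t), inferInstance⟩
  · rintro ⟨hp, hchar, hram⟩
    have : x.asIdeal.IsMaximal := x.isPrime.isMaximal hp
    let _ : Field (𝓞 k ⧸ x.asIdeal) := Ideal.Quotient.field _
    obtain ⟨a, b, e, he⟩ := hloc (𝓞 k ⧸ x.asIdeal)
    exact hu.not_smooth_fibre hp e he hram (smooth_of_smooth_morphismRestrict V hV x hx)

end SmoothLocus

end Integral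

theorem proposition2p3 (k L : Type u) [Field k] [Field L] [NumberField k] [NumberField L]
    [Algebra k L] [IsTotallyReal k] [IsTotallyComplex L] [Algebra.IsQuadraticExtension k L] :
    ∃ T : GroupSchemeOver (𝓞 k),
      T.Represents (integralNormOneGroup k L) ∧
      IsAffineHom T.X.hom ∧
      Flat T.X.hom ∧
      (T.baseChange k).Represents (normOneTorus k L) ∧
      (∀ (p : Ideal (𝓞 k)) [p.IsPrime], p ≠ ⊥ →
        (SplitsInQuadratic k L p →
          (T.baseChange (𝓞 k ⧸ p)).Represents (multiplicativeGroup (𝓞 k ⧸ p))) ∧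
        (IsInertInQuadratic k L p →
          ∀ (l : Type u) [Field l] [Algebra (𝓞 k ⧸ p) l]
            [Algebra.IsQuadraticExtension (𝓞 k ⧸ p) l],
            (T.baseChange (𝓞 k ⧸ p)).Represents (normOneTorus (𝓞 k ⧸ p) l)) ∧
        (IsRamifiedInQuadratic k L p →
          (T.baseChange (𝓞 k ⧸ p)).Represents (additiveTimesMuTwo (𝓞 k ⧸ p)))) ∧
      IsGreatest {V : (Spec (CommRingCat.of (𝓞 k))).Opens | Smooth (T.X.hom ∣_ V)}
        (tameLocus k L) := by
  obtain ⟨σ, hσ, hσσ, htr, hn⟩ := exists_conj_ringOfIntegers k L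
  have := Module.finitePresentation_of_finite (𝓞 k) (𝓞 L)
  have : Module.Projective (𝓞 k) (𝓞 L) := Module.Flat.projective_of_finitePresentation
  have hloc := hasQuadraticCoordinates (rankAtStalk_ringOfIntegers k L) hσσ htr hn
  obtain ⟨H, _, _, u, hfp, hu⟩ := exists_isUniversalNormOne σ
  obtain ⟨T, hT, hX⟩ := GroupSchemeOver.exists_represents _ _ (hu.corepresentableBy hσ)
  have hflat := hu.flat hloc
  let π := Spec.map (CommRingCat.ofHom (algebraMap (𝓞 k) H))
  have hX : T.X = Over.mk π := hX
  refine ⟨T, hT, ?_, ?_, represents_genericFibre hT hσ hloc, fun p _ hp => ?_, ?_⟩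
  · rw [hX]
    exact (inferInstance : IsAffineHom π)
  · rw [hX]
    exact (HasRingHomProperty.Spec_iff (P := @Flat)).2 (RingHom.flat_algebraMap_iff.2 hflat)
  · have : p.IsMaximal := Ideal.IsPrime.isMaximal inferInstance hp
    let _ : Field (𝓞 k ⧸ p) := Ideal.Quotient.field p
    obtain ⟨a, b, e, he⟩ := hloc (𝓞 k ⧸ p)
    exact ⟨represents_fibre_of_splits hT hσ hp e he,
      fun h l => represents_fibre_of_isInert hT hσ hp e he h l,
      represents_fibre_of_isRamified hT hσ hp e he⟩
  · rw [hX]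
    exact hu.isGreatest_smooth hfp hσσ hloc htr
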